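/- All graphs are finite and undirected, and multiple edges are allowed. For a graph $G=(V,E)$ the chromatic polynomial is $P_G(q)=\sum_{A\subseteq E}(-1)^{|A|}q^{k(A)}$, where $k(A)$ is the number of connected components of $(V,A)$. For distinct vertices $x,y$ of $G$ let $\lambda_G(x,y)$ be the maximum number of edge-disjoint paths from $x$ to $y$; the maxmaxflow of $G$ is $\Lambda(G)=\max_{x\ne y}\lambda_G(x,y)$. A 2-terminal graph $(G,s,t)$ is a graph $G$ with two distinct distinguished vertices $s,t$. For 2-terminal graphs $(G_1,s_1,t_1)$ and $(G_2,s_2,t_2)$ on disjoint vertex sets, the parallel composition is obtained from $G_1\cup G_2$ by identifying $s_2$ with $s_1$ and $t_2$ with $t_1$, with terminals $s_1,t_1$; the series composition is obtained by identifying $t_1$ with $s_2$, with terminals $s_1,t_2$. The Wheatstone bridge is $K_4$ minus an edge, its two vertices of degree $2$ being the terminals. Let $\mathcal W$ be the smallest class of 2-terminal graphs (considered up to isomorphism) that contains $K_2$ (with its two vertices as terminals) and the Wheatstone bridge and is closed under series and parallel composition. **Theorem.** Fix an integer $\Lambda\ge 3$. The equation $(1+\rho)^\Lambda=2(1+\rho^2)^{\Lambda-1}$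 has a unique solution $\rho^\star_\Lambda$ in the interval $(0,1)$. Let $(G,s,t)\in\mathcal W$ be such that $G$ has maxmaxflow at most $\Lambda$. Then, for $q\in\mathbb C$, $P_G(q)\ne 0$ whenever $$|q-1|\ge \frac{1}{\rho^\star_\Lambda}\qquad\text{and}\qquad |q-2|\ge \frac{2(1-\rho X^2)}{X^2-1},$$ where $$\rho=\frac{1}{|q-1|}\qquad\text{and}\qquad X=\Bigl(\frac{2}{1+\rho}\Bigr)^{1/(\Lambda-1)}.$$ Moreover, when $\Lambda=3$ and $|q-1|\ge 1/\rho^\star_3$, the second condition is equivalent to $|q-2|\ge 2$. -/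

import Mathlib

open scoped Graph

/-! ## Multigraphs: components, multivariate Tutte polynomial, chromatic polynomial -/

namespace Graph

variable {α β : Type*}

/-- The number of connected components of a (finite) multigraph: the number of classes of
vertices under the equivalence relation generated by adjacency. -/
noncomputable def numComponents (G : Graph α β) : ℕ :=
  Nat.card (Quot fun x y : V(G) => G.Adj x y)

/-- The multivariate Tutte polynomial `Z_G(q, v) = ∑_{A ⊆ E} q ^ k(A) ∏_{e ∈ A} v e` of a finite
multigraph `G`, where `k(A)` is the number of connected components of the spanning subgraph
`(V, A)`, evaluated at `q` and at the edge weights `v`. -/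
noncomputable def multivariateTutte {R : Type*} [CommRing R] (G : Graph α β) (q : R) (v : β → R) :
    R :=
  ∑ᶠ A ∈ 𝒫 E(G), q ^ (G.restrict A).numComponents * ∏ᶠ e ∈ A, v e

/-- The chromatic polynomial of a finite multigraph, evaluated at `q`:
`P_G(q) = Z_G(q, {-1})`. -/
noncomputable def chromaticPolynomial {R : Type*} [CommRing R] (G : Graph α β) (q : R) : R :=
  G.multivariateTutte q fun _ => -1

/-! ## Paths, maximum flow and maxmaxflow -/

/-- Walks in a multigraph; a walk records the edges that it uses. -/
inductive Walk (G : Graph α β) : α → α → Type _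
  | nil {x : α} (hx : x ∈ V(G)) : Walk G x x
  | cons {x y z : α} (e : β) (h : G.IsLink e x y) (p : Walk G y z) : Walk G x z

namespace Walk

variable {G : Graph α β}

/-- The list of vertices visited by a walk, in order. -/
def support {x y : α} : G.Walk x y → List α
  | nil (x := x) _ => [x]
  | cons (x := x) _ _ p => x :: p.support

/-- The list of edges used by a walk, in order. -/
def edges {x y : α} : G.Walk x y → List β
  | nil _ => []
  | cons e _ p => e :: p.edges

/-- A path is a walk that visits no vertex twice. -/
def IsPath {x y : α} (p : G.Walk x y) : Prop := p.support.Nodup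

end Walk

/-- There are `n` pairwise edge-disjoint paths from `x` to `y` in `G`. -/
def HasEdgeDisjointPaths (G : Graph α β) (x y : α) (n : ℕ) : Prop :=
  ∃ p : Fin n → G.Walk x y,
    (∀ i, (p i).IsPath) ∧ Pairwise fun i j => (p i).edges.Disjoint (p j).edges

/-- The maximum flow `λ_G(x, y)` between distinct vertices `x`, `y`: the maximum number of
edge-disjoint paths from `x` to `y`. -/
noncomputable def maxFlow (G : Graph α β) (x y : α) : ℕ∞ :=
  ⨆ (n : ℕ) (_ : G.HasEdgeDisjointPaths x y n), (n : ℕ∞)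

/-- The maxmaxflow `Λ(G)`: the maximum of `λ_G(x, y)` over all pairs of distinct vertices. -/
noncomputable def maxmaxflow (G : Graph α β) : ℕ∞ :=
  ⨆ (x ∈ V(G)) (y ∈ V(G)) (_ : x ≠ y), G.maxFlow x y

/-- `G` is the union of its subgraphs `G₁` and `G₂`, which have no edge in common. -/
structure IsEdgeDisjointUnion (G G₁ G₂ : Graph α β) : Prop where
  left_le : G₁ ≤ G
  right_le : G₂ ≤ G
  vertexSet_eq : V(G) = V(G₁) ∪ V(G₂)
  edgeSet_eq : E(G) = E(G₁) ∪ E(G₂)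
  disjoint_edgeSet : Disjoint E(G₁) E(G₂)

end Graph

/-! ## 2-terminal graphs and the Wheatstone class -/

/-- A 2-terminal graph: a multigraph with two distinct distinguished vertices `s` and `t`. -/
structure TwoTerminalGraph (α β : Type*) where
  graph : Graph α β
  s : α
  t : α
  s_mem : s ∈ V(graph)
  t_mem : t ∈ V(graph)
  s_ne_t : s ≠ t

namespace TwoTerminalGraph

variable {α β : Type*}

/-- `H = G₁ ∥ G₂`, up to isomorphism. Identifying the sources and identifying the targets of
disjoint copies of `G₁` and `G₂` yields exactly a graph that is the union of (copies of) `G₁` and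
`G₂`, sharing no edge and exactly the two terminal vertices. -/
structure IsParallelComposition (H G₁ G₂ : TwoTerminalGraph α β) : Prop where
  union : H.graph.IsEdgeDisjointUnion G₁.graph G₂.graph
  inter : V(G₁.graph) ∩ V(G₂.graph) = {H.s, H.t}
  left_s : G₁.s = H.s
  left_t : G₁.t = H.t
  right_s : G₂.s = H.s
  right_t : G₂.t = H.t

/-- `H = G₁ ⋈ G₂`, up to isomorphism. Identifying the target of `G₁` with the source of `G₂` in
disjoint copies of them yields exactly a graph that is the union of (copies of) `G₁` and `G₂`,
sharing no edge and exactly the one vertex `G₁.t = G₂.s`. -/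
structure IsSeriesComposition (H G₁ G₂ : TwoTerminalGraph α β) : Prop where
  union : H.graph.IsEdgeDisjointUnion G₁.graph G₂.graph
  inter : V(G₁.graph) ∩ V(G₂.graph) = {G₁.t}
  middle : G₁.t = G₂.s
  left_s : G₁.s = H.s
  right_t : G₂.t = H.t

/-- `G` is `K₂`: two vertices, which are the terminals, and a single edge joining them. -/
def IsSingleEdge (G : TwoTerminalGraph α β) : Prop :=
  V(G.graph) = {G.s, G.t} ∧ ∃ e, E(G.graph) = {e} ∧ G.graph.IsLink e G.s G.t

/-- `G` is the Wheatstone bridge: `K₄` minus the edge `st`, on the vertices `s, t, a, b`, the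
terminals `s` and `t` being its two vertices of degree `2`. -/
def IsWheatstoneBridge (G : TwoTerminalGraph α β) : Prop :=
  ∃ a b, [G.s, G.t, a, b].Nodup ∧ V(G.graph) = {G.s, G.t, a, b} ∧
    ∃ e₁ e₂ e₃ e₄ e₅, [e₁, e₂, e₃, e₄, e₅].Nodup ∧ E(G.graph) = {e₁, e₂, e₃, e₄, e₅} ∧
      G.graph.IsLink e₁ G.s a ∧ G.graph.IsLink e₂ G.s b ∧ G.graph.IsLink e₃ a b ∧
      G.graph.IsLink e₄ a G.t ∧ G.graph.IsLink e₅ b G.t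

/-- The class `𝒲`: the smallest class of 2-terminal graphs that contains `K₂` and the Wheatstone
bridge and is closed under series and parallel composition. -/
inductive InWheatstoneClass : TwoTerminalGraph α β → Prop
  | singleEdge {G : TwoTerminalGraph α β} (h : G.IsSingleEdge) : InWheatstoneClass G
  | bridge {G : TwoTerminalGraph α β} (h : G.IsWheatstoneBridge) : InWheatstoneClass G
  | parallel {H G₁ G₂ : TwoTerminalGraph α β} (h : H.IsParallelComposition G₁ G₂)
      (h₁ : InWheatstoneClass G₁) (h₂ : InWheatstoneClass G₂) : InWheatstoneClass H
  | series {H G₁ G₂ : TwoTerminalGraph α β} (h : H.IsSeriesComposition G₁ G₂)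
      (h₁ : InWheatstoneClass G₁) (h₂ : InWheatstoneClass G₂) : InWheatstoneClass H

end TwoTerminalGraph

/-! ## The constants -/

/-- `ρ` is a solution in `(0, 1)` of the equation `(1 + ρ) ^ Λ = 2 (1 + ρ²) ^ (Λ - 1)`; for
`Λ ≥ 3` the constant `ρ⋆_Λ` is the unique one. -/
def IsRhoStar (Λ : ℕ) (ρ : ℝ) : Prop :=
  0 < ρ ∧ ρ < 1 ∧ (1 + ρ) ^ Λ = 2 * (1 + ρ ^ 2) ^ (Λ - 1)

/-- `X = (2 / (1 + ρ)) ^ (1 / (Λ - 1))`. -/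
noncomputable def wheatstoneX (Λ : ℕ) (ρ : ℝ) : ℝ :=
  (2 / (1 + ρ)) ^ (1 / ((Λ : ℝ) - 1))

/-- The bound `2 (1 - ρ X²) / (X² - 1)`, where `ρ = 1 / |q - 1|`. -/
noncomputable def wheatstoneBound (Λ : ℕ) (q : ℂ) : ℝ :=
  let ρ : ℝ := 1 / ‖q - 1‖
  let X : ℝ := wheatstoneX Λ ρ
  2 * (1 - ρ * X ^ 2) / (X ^ 2 - 1)

/-! Write `z` for the chromatic polynomial of a 2-terminal graph and `c` for the part of it coming
from edge sets that join the terminals. Everything is governed by the transmissivity `c / z`. In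
series transmissivities multiply; in parallel `t₁` and `t₂` give `(t₁ + t₂ + (q - 2) t₁ t₂) / (1 +
(q - 1) t₁ t₂)`. A single edge has transmissivity `-1 / (q - 1)`, of modulus `ρ`, and the bridge has
`2 / ((q - 1) (q - 2))`. To avoid division all of this is stated for `z` and `c`.

The radii `r k = ρ (X ^ k - 1) / (1 - ρ X ^ k)` are chosen so that a parallel composition of discs
of radii `r k` and `r l` lands in the disc of radius `r (k + l)`, and so that `r (Λ - 1) = ρ`. The
invariant is that either the transmissivity equals that of an edge, or it is bounded by `r k` for
some number `k ≤ Λ - 1` of edge-disjoint connections between the terminals. The edge value is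
absorbing under parallel composition. A series composition has transmissivity of modulus at most `ρ
^ 2`, and `ρ ^ 2 ≤ r 1` is where `ρ ≤ ρ⋆` is needed. The bridge carries flow 2, and its bound by `r
2` is exactly the condition on `|q - 2|`.

The limit `k ≤ Λ - 1` comes from the surrounding graph: if the terminals are also joined outside the
piece, that connection adds one to the flow, which is at most `Λ`. This is
`InWheatstoneClass.transmissivityBound`. The whole graph has no such bypass, so only nonvanishing is
proved for it: a series composition factors into its parts, and in a parallel composition each part
bypasses the other, so `|(q - 1) t₁ t₂| ≤ ρ < 1`. -/

namespace Graph

/-! ### Connected components of a graph glued from two pieces -/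

variable {α β : Type*}

/-- Two vertices are connected when a sequence of adjacent vertices leads from one to the other. -/
def Conn (G : Graph α β) : α → α → Prop := Relation.ReflTransGen G.Adj

namespace Conn

variable {G H : Graph α β} {x y z : α}

theorem refl (G : Graph α β) (x : α) : G.Conn x x := Relation.ReflTransGen.refl

theorem symm (h : G.Conn x y) : G.Conn y x :=
  Std.Symm.symm (r := Relation.ReflTransGen G.Adj) _ _ h

theorem trans (h : G.Conn x y) (h' : G.Conn y z) : G.Conn x z := Relation.ReflTransGen.trans h h'

theorem of_adj (h : G.Adj x y) : G.Conn x y := Relation.ReflTransGen.single h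

theorem mono (hGH : G ≤ H) (h : G.Conn x y) : H.Conn x y :=
  Relation.ReflTransGen.mono (fun _ _ h => h.mono hGH) _ _ h

theorem lift {L : Type*} {f : α → L} (hf : ∀ x y, G.Adj x y → f x = f y) (h : G.Conn x y) :
    f x = f y := by
  induction h with
  | refl => rfl
  | tail _ h ih => exact ih.trans (hf _ _ h)

end Conn

/-- `f` labels the vertices of `G` by their connected components. -/
def IsClassifier {L : Type*} (G : Graph α β) (f : α → L) : Prop :=
  ∀ x ∈ V(G), ∀ y ∈ V(G), f x = f y ↔ G.Conn x y

theorem quot_mk_eq_iff (G : Graph α β) (x y : V(G)) :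
    Quot.mk (fun x y : V(G) => G.Adj x y) x = Quot.mk _ y ↔ G.Conn x y := by
  constructor
  · intro h
    have h' := Quot.eqvGen_exact h
    clear h
    induction h' with
    | rel x y h => exact Conn.of_adj h
    | refl x => exact Conn.refl _ _
    | symm x y _ ih => exact ih.symm
    | trans x y z _ _ ih₁ ih₂ => exact ih₁.trans ih₂
  · intro h
    obtain ⟨x, hx⟩ := x
    obtain ⟨y, hy⟩ := y
    change G.Conn x y at h
    induction h with
    | refl => rfl
    | tail _ h ih => exact (ih h.left_mem).trans (Quot.sound h)

theorem IsClassifier.numComponents_eq {L : Type*} {G : Graph α β} {f : α → L}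
    (hf : G.IsClassifier f) : G.numComponents = (f '' V(G)).ncard := by
  rw [numComponents, ← Nat.card_coe_set_eq]
  refine Nat.card_congr (Equiv.ofBijective
    (Quot.lift (fun x : V(G) => (⟨f x, x, x.2, rfl⟩ : f '' V(G))) ?_) ⟨?_, ?_⟩)
  · intro x y h
    exact Subtype.ext ((hf x x.2 y y.2).2 (Conn.of_adj h))
  · rintro ⟨x⟩ ⟨y⟩ h
    exact (quot_mk_eq_iff G x y).2 ((hf x x.2 y y.2).1 (congrArg Subtype.val h))
  · rintro ⟨_, x, hx, rfl⟩
    exact ⟨Quot.mk _ ⟨x, hx⟩, rfl⟩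

theorem isClassifier_setOf_conn (G : Graph α β) : G.IsClassifier fun x => {y | G.Conn x y} := by
  intro x _ y _
  constructor
  · intro h
    exact (Set.ext_iff.1 h y).2 (Conn.refl G y)
  · intro h
    ext z
    exact ⟨fun hz => h.symm.trans hz, fun hz => h.trans hz⟩

namespace IsEdgeDisjointUnion

variable {G G₁ G₂ : Graph α β}

theorem symm (h : G.IsEdgeDisjointUnion G₁ G₂) : G.IsEdgeDisjointUnion G₂ G₁ where
  left_le := h.right_le
  right_le := h.left_le
  vertexSet_eq := by rw [h.vertexSet_eq, Set.union_comm]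
  edgeSet_eq := by rw [h.edgeSet_eq, Set.union_comm]
  disjoint_edgeSet := h.disjoint_edgeSet.symm

theorem adj_iff (h : G.IsEdgeDisjointUnion G₁ G₂) {x y : α} :
    G.Adj x y ↔ G₁.Adj x y ∨ G₂.Adj x y := by
  constructor
  · rintro ⟨e, he⟩
    have : e ∈ E(G₁) ∪ E(G₂) := h.edgeSet_eq ▸ he.edge_mem
    rcases this with h' | h'
    · exact .inl ⟨e, (h.left_le.isLink_iff h').2 he⟩
    · exact .inr ⟨e, (h.right_le.isLink_iff h').2 he⟩
  · rintro (h' | h')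
    exacts [h'.mono h.left_le, h'.mono h.right_le]

theorem restrict (h : G.IsEdgeDisjointUnion G₁ G₂) {A₁ A₂ : Set β} (h₁ : A₁ ⊆ E(G₁))
    (h₂ : A₂ ⊆ E(G₂)) :
    (G.restrict (A₁ ∪ A₂)).IsEdgeDisjointUnion (G₁.restrict A₁) (G₂.restrict A₂) where
  left_le := (restrict_mono_left h.left_le _).trans (restrict_mono_right _ Set.subset_union_left)
  right_le := (restrict_mono_left h.right_le _).trans (restrict_mono_right _ Set.subset_union_right)
  vertexSet_eq := h.vertexSet_eq
  edgeSet_eq := by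
    have := h.edgeSet_eq
    ext e
    have he : e ∈ E(G) ↔ e ∈ E(G₁) ∨ e ∈ E(G₂) := by rw [this]; rfl
    have := @h₁ e
    have := @h₂ e
    simp only [edgeSet_restrict, Set.mem_inter_iff, Set.mem_union]
    tauto
  disjoint_edgeSet := h.disjoint_edgeSet.mono (by simp) (by simp)

/-- Gluing along `V(G₁) ∩ V(G₂)`, when `G₁` connects all the common vertices that `G₂` connects. -/
theorem conn_and_numComponents (h : G.IsEdgeDisjointUnion G₁ G₂) (hfin : V(G).Finite)
    (hK : ∀ u ∈ V(G₁) ∩ V(G₂), ∀ w ∈ V(G₁) ∩ V(G₂), G₂.Conn u w → G₁.Conn u w) :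
    (∀ x ∈ V(G₁), ∀ y ∈ V(G₁), G.Conn x y ↔ G₁.Conn x y) ∧
    (∀ x ∈ V(G₁), ∀ y ∈ V(G₂), G.Conn x y ↔ ∃ u ∈ V(G₁) ∩ V(G₂), G₁.Conn x u ∧ G₂.Conn u y) ∧
    G.numComponents + ((fun x => {y | G₂.Conn x y}) '' (V(G₁) ∩ V(G₂))).ncard =
      G₁.numComponents + G₂.numComponents := by
  classical
  set f₁ : α → Set α := fun x => {y | G₁.Conn x y} with hf₁
  set f₂ : α → Set α := fun x => {y | G₂.Conn x y} with hf₂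
  have c₁ : G₁.IsClassifier f₁ := isClassifier_setOf_conn G₁
  have c₂ : G₂.IsClassifier f₂ := isClassifier_setOf_conn G₂
  have hv₁ : V(G₁) ⊆ V(G) := h.left_le.vertexSet_mono
  have hv₂ : V(G₂) ⊆ V(G) := h.right_le.vertexSet_mono
  -- A component of `G₂` that meets the overlap takes the `G₁`-label of a chosen common vertex; `hK`
  -- makes the label independent of the choice.
  let g : Set α → Set α ⊕ Set α := fun c =>
    if hc : ∃ u ∈ V(G₁) ∩ V(G₂), f₂ u = c then .inl (f₁ hc.choose) else .inr c
  let f : α → Set α ⊕ Set α := fun x => if x ∈ V(G₁) then .inl (f₁ x) else g (f₂ x)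
  have hl : ∀ x ∈ V(G₁), f x = .inl (f₁ x) := fun x hx => if_pos hx
  have hg : ∀ u ∈ V(G₁) ∩ V(G₂), g (f₂ u) = .inl (f₁ u) := by
    intro u hu
    have hc : ∃ w ∈ V(G₁) ∩ V(G₂), f₂ w = f₂ u := ⟨u, hu, rfl⟩
    have e : g (f₂ u) = .inl (f₁ hc.choose) := dif_pos hc
    rw [e]
    obtain ⟨hw, hw'⟩ := hc.choose_spec
    rw [(c₁ _ hw.1 u hu.1).2 (hK _ hw _ hu ((c₂ _ hw.2 u hu.2).1 hw'))]
  have hr : ∀ x ∈ V(G₂), f x = g (f₂ x) := by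
    intro x hx
    by_cases h' : x ∈ V(G₁)
    · rw [hl x h', hg x ⟨h', hx⟩]
    · exact if_neg h'
  have hcase : ∀ x ∈ V(G₂), (∃ u ∈ V(G₁) ∩ V(G₂), G₂.Conn u x ∧ f x = .inl (f₁ u)) ∨
      (f x = .inr (f₂ x) ∧ ¬ ∃ u ∈ V(G₁) ∩ V(G₂), f₂ u = f₂ x) := by
    intro x hx
    rw [hr x hx]
    by_cases hc : ∃ u ∈ V(G₁) ∩ V(G₂), f₂ u = f₂ x
    · obtain ⟨u, hu, hux⟩ := hc
      exact .inl ⟨u, hu, (c₂ u hu.2 x hx).1 hux, by rw [← hux, hg u hu]⟩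
    · exact .inr ⟨dif_neg hc, hc⟩
  have hconn : ∀ x y, G.Conn x y → f x = f y := by
    intro x y hxy
    refine hxy.lift fun x y hadj => ?_
    rcases h.adj_iff.1 hadj with h' | h'
    · rw [hl x h'.left_mem, hl y h'.right_mem,
        (c₁ x h'.left_mem y h'.right_mem).2 (Conn.of_adj h')]
    · rw [hr x h'.left_mem, hr y h'.right_mem,
        (c₂ x h'.left_mem y h'.right_mem).2 (Conn.of_adj h')]
  have hcase' : ∀ x ∈ V(G), (∃ u ∈ V(G₁), G.Conn u x ∧ f x = .inl (f₁ u)) ∨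
      (x ∈ V(G₂) ∧ f x = .inr (f₂ x)) := by
    intro x hx
    rw [h.vertexSet_eq] at hx
    rcases hx with hx | hx
    · exact .inl ⟨x, hx, Conn.refl _ _, hl x hx⟩
    · rcases hcase x hx with ⟨u, hu, hux, hfx⟩ | ⟨hfx, -⟩
      · exact .inl ⟨u, hu.1, hux.mono h.right_le, hfx⟩
      · exact .inr ⟨hx, hfx⟩
  have cf : G.IsClassifier f := by
    intro x hx y hy
    refine ⟨fun hxy => ?_, hconn x y⟩
    rcases hcase' x hx with ⟨u, hu, hux, hfx⟩ | ⟨hx₂, hfx⟩ <;>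
    rcases hcase' y hy with ⟨w, hw, hwy, hfy⟩ | ⟨hy₂, hfy⟩ <;>
    rw [hfx, hfy] at hxy
    · exact hux.symm.trans
        ((((c₁ u hu w hw).1 (Sum.inl.inj hxy)).mono h.left_le).trans hwy)
    · cases hxy
    · cases hxy
    · exact ((c₂ x hx₂ y hy₂).1 (Sum.inr.inj hxy)).mono h.right_le
  refine ⟨fun x hx y hy => ?_, fun x hx y hy => ?_, ?_⟩
  · rw [← cf x (hv₁ hx) y (hv₁ hy), hl x hx, hl y hy, Sum.inl_injective.eq_iff, c₁ x hx y hy]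
  · constructor
    · intro hxy
      have e := hconn x y hxy
      rcases hcase y hy with ⟨u, hu, huy, hfy⟩ | ⟨hfy, -⟩ <;> rw [hl x hx, hfy] at e
      · exact ⟨u, hu, (c₁ x hx u hu.1).1 (Sum.inl.inj e), huy⟩
      · cases e
    · rintro ⟨u, -, h₁, h₂⟩
      exact (h₁.mono h.left_le).trans (h₂.mono h.right_le)
  · rw [cf.numComponents_eq, c₁.numComponents_eq, c₂.numComponents_eq]
    -- The components of `G` are those of `G₁` together with the components of `G₂` that miss the
    -- overlap.
    have himage : f '' V(G) = Sum.inl '' (f₁ '' V(G₁)) ∪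
        Sum.inr '' ((f₂ '' V(G₂)) \ (f₂ '' (V(G₁) ∩ V(G₂)))) := by
      ext c
      constructor
      · rintro ⟨x, hx, rfl⟩
        by_cases hx₁ : x ∈ V(G₁)
        · exact .inl ⟨_, ⟨x, hx₁, rfl⟩, (hl x hx₁).symm⟩
        have hx₂ : x ∈ V(G₂) := (h.vertexSet_eq ▸ hx : x ∈ V(G₁) ∪ V(G₂)).resolve_left hx₁
        rcases hcase x hx₂ with ⟨u, hu, -, hfx⟩ | ⟨hfx, hne⟩
        · exact .inl ⟨_, ⟨u, hu.1, rfl⟩, hfx.symm⟩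
        · exact .inr ⟨_, ⟨⟨x, hx₂, rfl⟩, fun ⟨u, hu, e⟩ => hne ⟨u, hu, e⟩⟩, hfx.symm⟩
      · rintro (⟨_, ⟨x, hx, rfl⟩, rfl⟩ | ⟨_, ⟨⟨x, hx, rfl⟩, hne⟩, rfl⟩)
        · exact ⟨x, hv₁ hx, hl x hx⟩
        · refine ⟨x, hv₂ hx, ?_⟩
          rcases hcase x hx with ⟨u, hu, hux, -⟩ | ⟨hfx, -⟩
          · exact absurd ⟨u, hu, (c₂ u hu.2 x hx).2 hux⟩ hne
          · exact hfx
    have fin₁ : (f₁ '' V(G₁)).Finite := (hfin.subset hv₁).image _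
    have fin₂ : (f₂ '' V(G₂)).Finite := (hfin.subset hv₂).image _
    rw [himage, Set.ncard_union_eq _ (fin₁.image _) (fin₂.sdiff.image _),
      Set.ncard_image_of_injective _ Sum.inl_injective,
      Set.ncard_image_of_injective _ Sum.inr_injective, add_assoc,
      Set.ncard_sdiff_add_ncard_of_subset (Set.image_mono Set.inter_subset_right) fin₂]
    rw [Set.disjoint_left]
    rintro _ ⟨_, -, rfl⟩ ⟨_, -, e⟩
    cases e

end IsEdgeDisjointUnion

end Graph

/-! ### Series and parallel laws for the chromatic and connecting polynomials -/

namespace Graph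

variable {α β : Type*} {G G₁ G₂ : Graph α β}

namespace IsEdgeDisjointUnion

theorem series_components (h : G.IsEdgeDisjointUnion G₁ G₂) (hfin : V(G).Finite) {s m t : α}
    (hm : V(G₁) ∩ V(G₂) = {m}) (hs : s ∈ V(G₁)) (ht : t ∈ V(G₂)) :
    (G.Conn s t ↔ G₁.Conn s m ∧ G₂.Conn m t) ∧
      G.numComponents + 1 = G₁.numComponents + G₂.numComponents := by
  obtain ⟨-, h₁, h₂⟩ := h.conn_and_numComponents hfin (by
    rw [hm]
    rintro u rfl w rfl -
    exact Conn.refl _ _)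
  refine ⟨by simpa [hm] using h₁ s hs t ht, ?_⟩
  rwa [hm, Set.image_singleton, Set.ncard_singleton] at h₂

open Classical in
theorem parallel_components (h : G.IsEdgeDisjointUnion G₁ G₂) (hfin : V(G).Finite) {s t : α}
    (hst : V(G₁) ∩ V(G₂) = {s, t}) :
    (G.Conn s t ↔ G₁.Conn s t ∨ G₂.Conn s t) ∧
      G.numComponents + (if G₁.Conn s t ∧ G₂.Conn s t then 1 else 2) =
        G₁.numComponents + G₂.numComponents := by
  have key : ∀ {G₁ G₂ : Graph α β}, G.IsEdgeDisjointUnion G₁ G₂ → V(G₁) ∩ V(G₂) = {s, t} →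
      (G₂.Conn s t → G₁.Conn s t) → (G.Conn s t ↔ G₁.Conn s t ∨ G₂.Conn s t) ∧
      G.numComponents + (if G₁.Conn s t ∧ G₂.Conn s t then 1 else 2) =
        G₁.numComponents + G₂.numComponents := by
    clear h hst
    intro G₁ G₂ h hst himp
    obtain ⟨h₁, -, h₂⟩ := h.conn_and_numComponents hfin (by
      rw [hst]
      rintro u (rfl | rfl) w (rfl | rfl) huw
      exacts [Conn.refl _ _, himp huw, (himp huw.symm).symm, Conn.refl _ _])
    have hs : s ∈ V(G₁) ∩ V(G₂) := by simp [hst]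
    have ht : t ∈ V(G₁) ∩ V(G₂) := by simp [hst]
    refine ⟨by rw [h₁ s hs.1 t ht.1]; tauto, ?_⟩
    rw [hst, Set.image_pair] at h₂
    have hcl : {y | G₂.Conn s y} = {y | G₂.Conn t y} ↔ G₂.Conn s t :=
      isClassifier_setOf_conn G₂ s hs.2 t ht.2
    by_cases hc : G₂.Conn s t
    · rw [if_pos ⟨himp hc, hc⟩]
      rwa [hcl.2 hc, Set.pair_eq_singleton, Set.ncard_singleton] at h₂
    · rw [if_neg fun h => hc h.2]
      rwa [Set.ncard_pair (fun e => hc (hcl.1 e))] at h₂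
  by_cases hc : G₂.Conn s t → G₁.Conn s t
  · exact key h hst hc
  -- Here only `G₂` joins the terminals, so the hypothesis of `key` holds with the roles exchanged.
  · have := key h.symm (by rw [Set.inter_comm, hst]) (by tauto)
    rw [or_comm, add_comm G₁.numComponents]
    simpa only [and_comm] using this

end IsEdgeDisjointUnion

section Polynomial

variable {R : Type*} [CommRing R]

open Classical in
/-- The part of the chromatic polynomial coming from the edge sets that connect `x` to `y`. -/
noncomputable def connectingPolynomial (G : Graph α β) (x y : α) (q : R) : R :=
  ∑ᶠ A ∈ 𝒫 E(G), if (G.restrict A).Conn x y then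
    q ^ (G.restrict A).numComponents * ∏ᶠ e ∈ A, (-1 : R) else 0

theorem finsum_mem_powerset_coe {F : Finset β} (f : Set β → R) :
    ∑ᶠ A ∈ 𝒫 (F : Set β), f A = ∑ B ∈ F.powerset, f B := by
  classical
  have hinj : Set.InjOn (fun B : Finset β => (B : Set β)) (F.powerset : Set (Finset β)) :=
    Finset.coe_injective.injOn
  have : 𝒫 (F : Set β) = (fun B : Finset β => (B : Set β)) '' (F.powerset : Set (Finset β)) := by
    ext A
    constructor
    · intro hA
      exact ⟨(F.finite_toSet.subset hA).toFinset, by simpa using hA, by simp⟩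
    · rintro ⟨B, hB, rfl⟩
      simpa using hB
  rw [this, finsum_mem_image hinj, finsum_mem_coe_finset]

/-- The signed monomial of an edge set. -/
noncomputable def chromaticTerm (G : Graph α β) (q : R) (B : Finset β) : R :=
  q ^ (G.restrict (B : Set β)).numComponents * (-1) ^ B.card

theorem chromaticPolynomial_eq_sum {F : Finset β} (hF : E(G) = F) (q : R) :
    G.chromaticPolynomial q = ∑ B ∈ F.powerset, G.chromaticTerm q B := by
  rw [chromaticPolynomial, multivariateTutte, hF, finsum_mem_powerset_coe]
  refine Finset.sum_congr rfl fun B _ => ?_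
  rw [finprod_mem_coe_finset, Finset.prod_const, chromaticTerm]

open Classical in
theorem connectingPolynomial_eq_sum {F : Finset β} (hF : E(G) = F) (x y : α) (q : R) :
    G.connectingPolynomial x y q =
      ∑ B ∈ F.powerset, if (G.restrict (B : Set β)).Conn x y then G.chromaticTerm q B else 0 := by
  rw [connectingPolynomial, hF, finsum_mem_powerset_coe]
  refine Finset.sum_congr rfl fun B _ => ?_
  rw [finprod_mem_coe_finset, Finset.prod_const, chromaticTerm]

theorem sum_powerset_union [DecidableEq β] {F₁ F₂ : Finset β} (h : Disjoint F₁ F₂)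
    (f : Finset β → R) :
    ∑ B ∈ (F₁ ∪ F₂).powerset, f B =
      ∑ B₁ ∈ F₁.powerset, ∑ B₂ ∈ F₂.powerset, f (B₁ ∪ B₂) := by
  rw [← Finset.sum_product']
  symm
  refine Finset.sum_nbij' (fun p => p.1 ∪ p.2) (fun B => (B ∩ F₁, B ∩ F₂)) ?_ ?_ ?_ ?_ ?_
  · rintro ⟨B₁, B₂⟩ hB
    simp only [Finset.mem_product, Finset.mem_powerset] at hB ⊢
    exact Finset.union_subset_union hB.1 hB.2
  · intro B _
    simp only [Finset.mem_product, Finset.mem_powerset]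
    exact ⟨Finset.inter_subset_right, Finset.inter_subset_right⟩
  · rintro ⟨B₁, B₂⟩ hB
    simp only [Finset.mem_product, Finset.mem_powerset] at hB
    rw [Finset.disjoint_left] at h
    ext e
    · have := @hB.1 e; have := @hB.2 e; have := @h e
      simp only [Finset.mem_inter, Finset.mem_union]; tauto
    · have := @hB.1 e; have := @hB.2 e; have := @h e
      simp only [Finset.mem_inter, Finset.mem_union]; tauto
  · intro B hB
    simp only [Finset.mem_powerset] at hB
    ext e
    have := @hB e
    simp only [Finset.mem_inter, Finset.mem_union] at *; tauto
  · intros; rfl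

theorem pow_mul_chromaticTerm_union [DecidableEq β] {B₁ B₂ : Finset β} (hd : Disjoint B₁ B₂)
    {d : ℕ} (hk : (G.restrict ((B₁ ∪ B₂ : Finset β) : Set β)).numComponents + d =
      (G₁.restrict (B₁ : Set β)).numComponents + (G₂.restrict (B₂ : Set β)).numComponents) (q : R) :
    q ^ d * G.chromaticTerm q (B₁ ∪ B₂) = G₁.chromaticTerm q B₁ * G₂.chromaticTerm q B₂ := by
  simp only [chromaticTerm, Finset.card_union_of_disjoint hd]
  rw [mul_mul_mul_comm, ← pow_add, ← hk]
  ring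

namespace IsEdgeDisjointUnion

theorem exists_finset (h : G.IsEdgeDisjointUnion G₁ G₂) (hE : E(G).Finite) [DecidableEq β] :
    ∃ F₁ F₂ : Finset β, E(G₁) = F₁ ∧ E(G₂) = F₂ ∧ E(G) = (F₁ ∪ F₂ : Finset β) ∧
      Disjoint F₁ F₂ := by
  have h₁ := hE.subset h.left_le.edgeSet_mono
  have h₂ := hE.subset h.right_le.edgeSet_mono
  refine ⟨h₁.toFinset, h₂.toFinset, by simp, by simp, by simp [h.edgeSet_eq], ?_⟩
  have := h.disjoint_edgeSet
  rwa [← Finset.disjoint_coe, Set.Finite.coe_toFinset, Set.Finite.coe_toFinset]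

/-- Gluing at one vertex always loses exactly one component, so the sum over pairs of edge sets
factors up to one power of `q`. -/
theorem series_polynomials (h : G.IsEdgeDisjointUnion G₁ G₂) (hV : V(G).Finite) (hE : E(G).Finite)
    {s m t : α} (hm : V(G₁) ∩ V(G₂) = {m}) (hs : s ∈ V(G₁)) (ht : t ∈ V(G₂)) (q : R) :
    q * G.chromaticPolynomial q = G₁.chromaticPolynomial q * G₂.chromaticPolynomial q ∧
    q * G.connectingPolynomial s t q =
      G₁.connectingPolynomial s m q * G₂.connectingPolynomial m t q := by
  classical
  obtain ⟨F₁, F₂, hF₁, hF₂, hF, hd⟩ := h.exists_finset hE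
  have key : ∀ B₁ ∈ F₁.powerset, ∀ B₂ ∈ F₂.powerset,
      q * G.chromaticTerm q (B₁ ∪ B₂) = G₁.chromaticTerm q B₁ * G₂.chromaticTerm q B₂ ∧
      ((G.restrict ((B₁ ∪ B₂ : Finset β) : Set β)).Conn s t ↔
        (G₁.restrict (B₁ : Set β)).Conn s m ∧ (G₂.restrict (B₂ : Set β)).Conn m t) := by
    intro B₁ hB₁ B₂ hB₂
    rw [Finset.mem_powerset] at hB₁ hB₂
    have hu := h.restrict (A₁ := B₁) (A₂ := B₂) (by rw [hF₁]; exact_mod_cast hB₁)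
      (by rw [hF₂]; exact_mod_cast hB₂)
    obtain ⟨hc, hk⟩ := hu.series_components hV hm hs ht
    rw [Finset.coe_union]
    refine ⟨?_, hc⟩
    rw [← pow_mul_chromaticTerm_union (d := 1) (hd.mono hB₁ hB₂) (by rwa [Finset.coe_union]) q,
      pow_one]
  constructor
  · rw [chromaticPolynomial_eq_sum hF, chromaticPolynomial_eq_sum hF₁,
      chromaticPolynomial_eq_sum hF₂, sum_powerset_union hd, Finset.sum_mul_sum, Finset.mul_sum]
    refine Finset.sum_congr rfl fun B₁ hB₁ => ?_
    rw [Finset.mul_sum]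
    exact Finset.sum_congr rfl fun B₂ hB₂ => (key B₁ hB₁ B₂ hB₂).1
  · rw [connectingPolynomial_eq_sum hF, connectingPolynomial_eq_sum hF₁,
      connectingPolynomial_eq_sum hF₂, sum_powerset_union hd, Finset.sum_mul_sum, Finset.mul_sum]
    refine Finset.sum_congr rfl fun B₁ hB₁ => ?_
    rw [Finset.mul_sum]
    refine Finset.sum_congr rfl fun B₂ hB₂ => ?_
    obtain ⟨e, hc⟩ := key B₁ hB₁ B₂ hB₂
    by_cases h₁ : (G₁.restrict (B₁ : Set β)).Conn s m <;>
      by_cases h₂ : (G₂.restrict (B₂ : Set β)).Conn m t <;>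
      simp only [hc, h₁, h₂, e, and_self, and_true, and_false, if_true, if_false, mul_zero,
        zero_mul]

/-- Gluing at both terminals loses two components, except one when both edge sets join the
terminals. Those pairs therefore carry an extra factor `q`, which produces the corrections `q - 1`
and `q - 2`. -/
theorem parallel_polynomials (h : G.IsEdgeDisjointUnion G₁ G₂) (hV : V(G).Finite)
    (hE : E(G).Finite) {s t : α} (hst : V(G₁) ∩ V(G₂) = {s, t}) (q : R) :
    q ^ 2 * G.chromaticPolynomial q = G₁.chromaticPolynomial q * G₂.chromaticPolynomial q +
      (q - 1) * (G₁.connectingPolynomial s t q * G₂.connectingPolynomial s t q) ∧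
    q ^ 2 * G.connectingPolynomial s t q =
      G₁.connectingPolynomial s t q * G₂.chromaticPolynomial q +
      G₁.chromaticPolynomial q * G₂.connectingPolynomial s t q +
      (q - 2) * (G₁.connectingPolynomial s t q * G₂.connectingPolynomial s t q) := by
  classical
  obtain ⟨F₁, F₂, hF₁, hF₂, hF, hd⟩ := h.exists_finset hE
  have key : ∀ B₁ ∈ F₁.powerset, ∀ B₂ ∈ F₂.powerset,
      q ^ (if (G₁.restrict (B₁ : Set β)).Conn s t ∧ (G₂.restrict (B₂ : Set β)).Conn s t
        then 1 else 2) * G.chromaticTerm q (B₁ ∪ B₂) =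
          G₁.chromaticTerm q B₁ * G₂.chromaticTerm q B₂ ∧
      ((G.restrict ((B₁ ∪ B₂ : Finset β) : Set β)).Conn s t ↔
        (G₁.restrict (B₁ : Set β)).Conn s t ∨ (G₂.restrict (B₂ : Set β)).Conn s t) := by
    intro B₁ hB₁ B₂ hB₂
    rw [Finset.mem_powerset] at hB₁ hB₂
    have hu := h.restrict (A₁ := B₁) (A₂ := B₂) (by rw [hF₁]; exact_mod_cast hB₁)
      (by rw [hF₂]; exact_mod_cast hB₂)
    obtain ⟨hc, hk⟩ := hu.parallel_components hV hst
    rw [Finset.coe_union]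
    refine ⟨?_, hc⟩
    exact pow_mul_chromaticTerm_union (hd.mono hB₁ hB₂) (by rwa [Finset.coe_union]) q
  constructor
  · rw [chromaticPolynomial_eq_sum hF, chromaticPolynomial_eq_sum hF₁,
      chromaticPolynomial_eq_sum hF₂, connectingPolynomial_eq_sum hF₁,
      connectingPolynomial_eq_sum hF₂, sum_powerset_union hd, Finset.sum_mul_sum,
      Finset.sum_mul_sum, Finset.mul_sum, Finset.mul_sum, ← Finset.sum_add_distrib]
    refine Finset.sum_congr rfl fun B₁ hB₁ => ?_
    rw [Finset.mul_sum, Finset.mul_sum, ← Finset.sum_add_distrib]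
    refine Finset.sum_congr rfl fun B₂ hB₂ => ?_
    obtain ⟨e, -⟩ := key B₁ hB₁ B₂ hB₂
    by_cases h₁ : (G₁.restrict (B₁ : Set β)).Conn s t <;>
      by_cases h₂ : (G₂.restrict (B₂ : Set β)).Conn s t <;>
      simp only [h₁, h₂, and_self, and_true, and_false, if_true, if_false] at e ⊢ <;>
      rw [← e] <;> ring
  · rw [connectingPolynomial_eq_sum hF, chromaticPolynomial_eq_sum hF₁,
      chromaticPolynomial_eq_sum hF₂, connectingPolynomial_eq_sum hF₁,
      connectingPolynomial_eq_sum hF₂, sum_powerset_union hd, Finset.sum_mul_sum,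
      Finset.sum_mul_sum, Finset.sum_mul_sum, Finset.mul_sum, Finset.mul_sum,
      ← Finset.sum_add_distrib, ← Finset.sum_add_distrib]
    refine Finset.sum_congr rfl fun B₁ hB₁ => ?_
    rw [Finset.mul_sum, Finset.mul_sum, ← Finset.sum_add_distrib, ← Finset.sum_add_distrib]
    refine Finset.sum_congr rfl fun B₂ hB₂ => ?_
    obtain ⟨e, hc⟩ := key B₁ hB₁ B₂ hB₂
    by_cases h₁ : (G₁.restrict (B₁ : Set β)).Conn s t <;>
      by_cases h₂ : (G₂.restrict (B₂ : Set β)).Conn s t <;>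
      simp only [hc, h₁, h₂, and_self, and_true, and_false, or_self, or_true, or_false,
        if_true, if_false] at e ⊢ <;>
      first | (rw [← e]; ring) | ring

end IsEdgeDisjointUnion

end Polynomial

end Graph

/-! ### Explicit evaluation for the single edge and the bridge -/

namespace Graph

variable {α β : Type*} {G : Graph α β} {n : ℕ}

/-- Merge the class of `j` into the class of `i`. -/
def mergeLabels (f : Fin n → ℕ) (i j : Fin n) : Fin n → ℕ :=
  fun k => if f k = f j then f i else f k

/-- Labels of the vertices `v i` by the connected components of `(V, A)`. -/
def IsLabelling (G : Graph α β) (v : Fin n → α) (A : Set β) (f : Fin n → ℕ) : Prop :=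
  ∀ i j, f i = f j ↔ (G.restrict A).Conn (v i) (v j)

theorem isLabelling_empty {v : Fin n → α} (hv : v.Injective) : G.IsLabelling v ∅ (fun i => i) := by
  intro i j
  rw [Fin.val_inj]
  constructor
  · rintro rfl; exact Conn.refl _ _
  · intro h
    refine hv (h.lift (f := id) ?_)
    rintro x y ⟨e, he⟩
    exact absurd he.1 (Set.notMem_empty e)

theorem IsLabelling.insert {v : Fin n → α} (hv : v.Injective) (hV : Set.range v = V(G))
    {A : Set β} {f : Fin n → ℕ} (h : G.IsLabelling v A f) {e : β} {i j : Fin n}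
    (he : G.IsLink e (v i) (v j)) : G.IsLabelling v (insert e A) (mergeLabels f i j) := by
  have hmono {k l} (hkl : f k = f l) : (G.restrict (Insert.insert e A)).Conn (v k) (v l) :=
    ((h k l).1 hkl).mono (restrict_mono_right _ (Set.subset_insert _ _))
  have hij : (G.restrict (Insert.insert e A)).Conn (v i) (v j) :=
    Conn.of_adj ⟨e, Set.mem_insert _ _, he⟩
  intro k l
  constructor
  · intro hkl
    unfold mergeLabels at hkl
    split_ifs at hkl with h₁ h₂ h₂
    · exact hmono (h₁.trans h₂.symm)
    · exact (hmono h₁).trans (hij.symm.trans (hmono hkl))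
    · exact (hmono hkl).trans (hij.trans (hmono h₂.symm))
    · exact hmono hkl
  · intro hkl
    have key : ∀ x y, (G.restrict (Insert.insert e A)).Conn x y → ∀ k l, x = v k → y = v l →
        mergeLabels f i j k = mergeLabels f i j l := by
      intro x y hxy k l hx hy
      induction hxy generalizing l with
      | refl => rw [hv (hx.symm.trans hy)]
      | @tail y z _ hyz ih =>
        subst hy
        obtain ⟨e', he', hl⟩ := hyz
        obtain ⟨m, rfl⟩ : y ∈ Set.range v := hV ▸ hl.left_mem
        refine (ih m rfl).trans ?_
        rcases he' with rfl | he'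
        · rcases hl.eq_and_eq_or_eq_and_eq he with ⟨h₁, h₂⟩ | ⟨h₁, h₂⟩ <;>
          rw [hv h₁, hv h₂] <;> simp [mergeLabels]
        · have : f m = f l := (h m l).2 (Conn.of_adj ⟨e', he', hl⟩)
          simp only [mergeLabels, this]
    exact key _ _ hkl k l rfl rfl

theorem IsLabelling.numComponents_eq {v : Fin n → α} (hv : v.Injective) (hV : Set.range v = V(G))
    {A : Set β} {f : Fin n → ℕ} (h : G.IsLabelling v A f) :
    (G.restrict A).numComponents = (Finset.univ.image f).card := by
  have hc : (G.restrict A).IsClassifier (Function.extend v f 0) := by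
    intro x hx y hy
    obtain ⟨i, rfl⟩ : x ∈ Set.range v := hV ▸ hx
    obtain ⟨j, rfl⟩ : y ∈ Set.range v := hV ▸ hy
    rw [hv.extend_apply, hv.extend_apply, h i j]
  rw [hc.numComponents_eq, vertexSet_restrict, ← hV, ← Set.range_comp,
    show Function.extend v f 0 ∘ v = f from funext fun i => hv.extend_apply f 0 i,
    ← Set.ncard_coe_finset]
  simp

section LeafSum

variable {R : Type*} [CommRing R]

/-- The alternating sum of `g` over the labellings obtained by merging along the sublists of a
list of edges. -/
def leafSum (g : (Fin n → ℕ) → R) : List (Fin n × Fin n) → (Fin n → ℕ) → R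
  | [], f => g f
  | p :: l, f => leafSum g l f - leafSum g l (mergeLabels f p.1 p.2)

/-- Each edge is either omitted or added, and adding it merges two labels and flips the sign. The
set `A` accumulates the edges already added. -/
theorem sum_powerset_eq_leafSum [DecidableEq β] {v : Fin n → α} (hv : v.Injective)
    (hV : Set.range v = V(G)) {T : Finset β → R} {g : (Fin n → ℕ) → R}
    (hT : ∀ (A : Finset β) f, G.IsLabelling v (A : Set β) f → T A = g f * (-1) ^ A.card)
    (l : List (β × Fin n × Fin n)) (hl : ∀ p ∈ l, G.IsLink p.1 (v p.2.1) (v p.2.2))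
    (hnd : (l.map Prod.fst).Nodup) (A : Finset β) (hA : ∀ p ∈ l, p.1 ∉ A) {f : Fin n → ℕ}
    (hf : G.IsLabelling v (A : Set β) f) :
    ∑ B ∈ (l.map Prod.fst).toFinset.powerset, T (A ∪ B) =
      leafSum g (l.map Prod.snd) f * (-1) ^ A.card := by
  induction l generalizing A f with
  | nil => simpa [leafSum] using hT A f hf
  | cons p l ih =>
    simp only [List.map_cons, List.nodup_cons, List.mem_cons, forall_eq_or_imp] at hl hnd hA
    rw [List.map_cons, List.toFinset_cons,
      Finset.sum_powerset_insert (by simpa using hnd.1), ih hl.2 hnd.2 A hA.2 hf]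
    have hne : ∀ p' ∈ l, p'.1 ∉ Insert.insert p.1 A := by
      intro p' hp'
      rw [Finset.mem_insert, not_or]
      exact ⟨fun e => hnd.1 (e ▸ List.mem_map_of_mem hp'), hA.2 p' hp'⟩
    have := ih hl.2 hnd.2 (Insert.insert p.1 A) hne (f := mergeLabels f p.2.1 p.2.2)
      (by rw [Finset.coe_insert]; exact hf.insert hv hV hl.1)
    simp only [Finset.union_insert, Finset.insert_union] at this ⊢
    rw [this, Finset.card_insert_of_notMem hA.1, List.map_cons, leafSum, pow_succ]
    ring

theorem chromaticPolynomial_eq_leafSum {v : Fin n → α} (hv : v.Injective) (hV : Set.range v = V(G))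
    (l : List (β × Fin n × Fin n)) (hl : ∀ p ∈ l, G.IsLink p.1 (v p.2.1) (v p.2.2))
    (hnd : (l.map Prod.fst).Nodup) (hE : E(G) = {e | e ∈ l.map Prod.fst}) (q : R) :
    G.chromaticPolynomial q =
      leafSum (fun f => q ^ (Finset.univ.image f).card) (l.map Prod.snd) (fun i => i) := by
  classical
  rw [chromaticPolynomial_eq_sum (F := (l.map Prod.fst).toFinset) (by rw [hE]; ext; simp)]
  have := sum_powerset_eq_leafSum hv hV (T := G.chromaticTerm q)
    (g := fun f => q ^ (Finset.univ.image f).card)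
    (fun A f hf => by rw [chromaticTerm, hf.numComponents_eq hv hV])
    l hl hnd ∅ (by simp) (f := fun i => i) (by simpa using isLabelling_empty hv)
  simpa using this

theorem connectingPolynomial_eq_leafSum {v : Fin n → α} (hv : v.Injective) (hV : Set.range v = V(G))
    (l : List (β × Fin n × Fin n)) (hl : ∀ p ∈ l, G.IsLink p.1 (v p.2.1) (v p.2.2))
    (hnd : (l.map Prod.fst).Nodup) (hE : E(G) = {e | e ∈ l.map Prod.fst})
    (i j : Fin n) (q : R) :
    G.connectingPolynomial (v i) (v j) q =
      leafSum (fun f => if f i = f j then q ^ (Finset.univ.image f).card else 0)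
        (l.map Prod.snd) (fun i => i) := by
  classical
  rw [connectingPolynomial_eq_sum (F := (l.map Prod.fst).toFinset) (by rw [hE]; ext; simp)]
  have := sum_powerset_eq_leafSum hv hV
    (T := fun B => if (G.restrict (B : Set β)).Conn (v i) (v j) then G.chromaticTerm q B else 0)
    (g := fun f => if f i = f j then q ^ (Finset.univ.image f).card else 0)
    (fun A f hf => by
      simp only [chromaticTerm, hf.numComponents_eq hv hV, ← hf i j, ite_mul, zero_mul])
    l hl hnd ∅ (by simp) (f := fun i => i) (by simpa using isLabelling_empty hv)
  simpa using this

end LeafSum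

/-- The exponent is turned into decidable conditions, so that concrete instances of `leafSum` can be
evaluated by `decide`. -/
theorem pow_card_image_eq_ite {R : Type*} [CommRing R] (q : R) (hn : n ≤ 4) (f : Fin n → ℕ) :
    q ^ (Finset.univ.image f).card =
      if (Finset.univ.image f).card = 1 then q else
      if (Finset.univ.image f).card = 2 then q ^ 2 else
      if (Finset.univ.image f).card = 3 then q ^ 3 else
      if (Finset.univ.image f).card = 4 then q ^ 4 else 1 := by
  have : (Finset.univ.image f).card ≤ 4 :=
    Finset.card_image_le.trans (by simpa using hn)
  generalize (Finset.univ.image f).card = m at this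
  interval_cases m <;> simp

theorem edge_leafSum {R : Type*} [CommRing R] (q : R) :
    leafSum (n := 2) (fun f => q ^ (Finset.univ.image f).card) [(0, 1)] (fun i => i) = q ^ 2 - q ∧
    leafSum (n := 2) (fun f => if f 0 = f 1 then q ^ (Finset.univ.image f).card else 0) [(0, 1)]
      (fun i => i) = -q := by
  simp only [leafSum, pow_card_image_eq_ite (n := 2) q (by norm_num)]
  simp (decide := true)

/-- The indices `0` and `1` stand for the terminals, `2` and `3` for the inner vertices. -/
theorem bridge_leafSum {R : Type*} [CommRing R] (q : R) :
    leafSum (n := 4) (fun f => q ^ (Finset.univ.image f).card)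
      [(0, 2), (0, 3), (2, 3), (2, 1), (3, 1)] (fun i => i) = q * (q - 1) * (q - 2) ^ 2 ∧
    leafSum (n := 4) (fun f => if f 0 = f 1 then q ^ (Finset.univ.image f).card else 0)
      [(0, 2), (0, 3), (2, 3), (2, 1), (3, 1)] (fun i => i) = 2 * q * (q - 2) := by
  simp only [leafSum, pow_card_image_eq_ite (n := 4) q le_rfl]
  constructor
  · simp (decide := true) only [if_true, if_false]
    ring
  · simp (decide := true) only [if_true, if_false]
    ring

end Graph

namespace TwoTerminalGraph

variable {α β : Type*} {G : TwoTerminalGraph α β} {R : Type*} [CommRing R]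

theorem IsSingleEdge.polynomials (h : G.IsSingleEdge) (q : R) :
    G.graph.chromaticPolynomial q = q ^ 2 - q ∧
      G.graph.connectingPolynomial G.s G.t q = -q := by
  obtain ⟨hV, e, hE, he⟩ := h
  have hv : Function.Injective ![G.s, G.t] := by
    intro i j
    have := G.s_ne_t
    fin_cases i <;> fin_cases j <;> simp [this, this.symm]
  have hr : Set.range ![G.s, G.t] = V(G.graph) := by
    rw [hV]; simp [Set.pair_comm]
  have hl : ∀ p ∈ [(e, (0 : Fin 2), (1 : Fin 2))],
      G.graph.IsLink p.1 (![G.s, G.t] p.2.1) (![G.s, G.t] p.2.2) := by simpa using he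
  have hE' : E(G.graph) = {e' | e' ∈ [(e, (0 : Fin 2), (1 : Fin 2))].map Prod.fst} := by
    rw [hE]; ext; simp
  exact ⟨(Graph.chromaticPolynomial_eq_leafSum hv hr _ hl (by simp) hE' q).trans
      (Graph.edge_leafSum q).1,
    (Graph.connectingPolynomial_eq_leafSum hv hr _ hl (by simp) hE' 0 1 q).trans
      (Graph.edge_leafSum q).2⟩

theorem IsWheatstoneBridge.polynomials (h : G.IsWheatstoneBridge) (q : R) :
    G.graph.chromaticPolynomial q = q * (q - 1) * (q - 2) ^ 2 ∧
      G.graph.connectingPolynomial G.s G.t q = 2 * q * (q - 2) := by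
  obtain ⟨a, b, hnd, hV, e₁, e₂, e₃, e₄, e₅, hnde, hE, h₁, h₂, h₃, h₄, h₅⟩ := h
  have hv : Function.Injective ![G.s, G.t, a, b] := List.nodup_ofFn.1 (by simpa using hnd)
  have hr : Set.range ![G.s, G.t, a, b] = V(G.graph) := by
    rw [hV]; simp only [Matrix.range_cons, Matrix.range_empty]; ext; simp; tauto
  let l : List (β × Fin 4 × Fin 4) := [(e₁, 0, 2), (e₂, 0, 3), (e₃, 2, 3), (e₄, 2, 1), (e₅, 3, 1)]
  have hl : ∀ p ∈ l,
      G.graph.IsLink p.1 (![G.s, G.t, a, b] p.2.1) (![G.s, G.t, a, b] p.2.2) := by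
    simpa [l] using ⟨h₁, h₂, h₃, h₄, h₅⟩
  have hE' : E(G.graph) = {e' | e' ∈ l.map Prod.fst} := by
    rw [hE]; ext; simp [l]
  exact ⟨(Graph.chromaticPolynomial_eq_leafSum hv hr _ hl hnde hE' q).trans
      (Graph.bridge_leafSum q).1,
    (Graph.connectingPolynomial_eq_leafSum hv hr _ hl hnde hE' 0 1 q).trans
      (Graph.bridge_leafSum q).2⟩

end TwoTerminalGraph

/-! ### Flows as disjoint connecting edge sets -/

namespace Graph

variable {α β : Type*} {G H : Graph α β} {x y z : α}

namespace Walk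

/-- The rest of a walk from one of its vertices on. -/
theorem exists_drop (p : G.Walk x z) (hy : y ∈ p.support) :
    ∃ p' : G.Walk y z, p'.support <:+ p.support ∧ p'.edges ⊆ p.edges := by
  induction p with
  | nil hx =>
    obtain rfl : y = _ := List.mem_singleton.1 hy
    exact ⟨.nil hx, List.suffix_rfl, List.Subset.refl _⟩
  | cons e h p ih =>
    rcases List.mem_cons.1 hy with rfl | hy
    · exact ⟨.cons e h p, List.suffix_rfl, List.Subset.refl _⟩
    · obtain ⟨p', h₁, h₂⟩ := ih hy
      exact ⟨p', h₁.trans (List.suffix_cons _ _), fun _ he => List.mem_cons_of_mem _ (h₂ he)⟩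

end Walk

/-- Loop erasure: if the new first vertex already occurs on the path, only the tail from that
occurrence is kept. -/
theorem Conn.exists_isPath {F : Set β} (h : (G.restrict F).Conn x y) (hy : y ∈ V(G)) :
    ∃ p : G.Walk x y, p.IsPath ∧ ∀ e ∈ p.edges, e ∈ F := by
  induction h using Relation.ReflTransGen.head_induction_on with
  | refl => exact ⟨.nil hy, List.nodup_singleton _, fun e he => absurd he List.not_mem_nil⟩
  | @head x z hxz _ ih =>
    obtain ⟨e, heF, he⟩ := hxz
    obtain ⟨p, hp, hpF⟩ := ih
    by_cases hx : x ∈ p.support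
    · obtain ⟨p', h₁, h₂⟩ := p.exists_drop hx
      exact ⟨p', List.Nodup.sublist h₁.sublist hp, fun e he => hpF e (h₂ he)⟩
    · refine ⟨.cons e he p, List.nodup_cons.2 ⟨hx, hp⟩, fun e' he' => ?_⟩
      rcases List.mem_cons.1 he' with rfl | he'
      exacts [heF, hpF e' he']

/-- `S` contains `n` disjoint edge sets each of which connects `x` to `y`. -/
inductive HasFlow (G : Graph α β) (x y : α) : ℕ → Set β → Prop
  | zero (S : Set β) : HasFlow G x y 0 S
  | succ {n : ℕ} {F S T : Set β} (hF : (G.restrict F).Conn x y) (hS : HasFlow G x y n S)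
      (hd : Disjoint F S) (hT : F ∪ S ⊆ T) : HasFlow G x y (n + 1) T

namespace HasFlow

variable {n m : ℕ} {S T : Set β}

theorem mono_right (h : G.HasFlow x y n S) (hST : S ⊆ T) : G.HasFlow x y n T := by
  cases h with
  | zero => exact .zero T
  | succ hF hS hd hT => exact .succ hF hS hd (hT.trans hST)

theorem mono_left (h : G.HasFlow x y n S) (hGH : G ≤ H) : H.HasFlow x y n S := by
  induction h with
  | zero S => exact .zero S
  | succ hF _ hd hT ih => exact .succ (hF.mono (restrict_mono_left hGH _)) ih hd hT

theorem of_conn (h : (G.restrict S).Conn x y) : G.HasFlow x y 1 S :=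
  .succ h (.zero ∅) (Set.disjoint_empty S) (by simp)

/-- Working with edge sets instead of paths makes flows add by mere union; paths are extracted only
when comparing with `maxmaxflow`. -/
theorem add (h : G.HasFlow x y n S) (h' : G.HasFlow x y m T) (hd : Disjoint S T) :
    G.HasFlow x y (n + m) (S ∪ T) := by
  induction h with
  | zero S => simpa using h'.mono_right Set.subset_union_right
  | @succ n F S S' hF _ hd' hT ih =>
    have hFS := Set.union_subset_iff.1 hT
    rw [Nat.add_right_comm]
    refine .succ hF (ih (hd.mono_left hFS.2)) ?_ ?_
    · exact Set.disjoint_union_right.2 ⟨hd', hd.mono_left hFS.1⟩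
    · rw [← Set.union_assoc]
      exact Set.union_subset_union_left _ hT

theorem hasEdgeDisjointPaths (h : G.HasFlow x y n S) (hy : y ∈ V(G)) :
    G.HasEdgeDisjointPaths x y n := by
  suffices ∃ p : Fin n → G.Walk x y, (∀ i, (p i).IsPath) ∧
      (Pairwise fun i j => (p i).edges.Disjoint (p j).edges) ∧ ∀ i, ∀ e ∈ (p i).edges, e ∈ S by
    obtain ⟨p, h₁, h₂, -⟩ := this
    exact ⟨p, h₁, h₂⟩
  induction h with
  | zero S => exact ⟨Fin.elim0, fun i => i.elim0, fun i => i.elim0, fun i => i.elim0⟩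
  | @succ n F S T hF _ hd hT ih =>
    obtain ⟨p, h₁, h₂, h₃⟩ := ih
    obtain ⟨p₀, h₀, h₀F⟩ := hF.exists_isPath hy
    have hFS := Set.union_subset_iff.1 hT
    have hdisj : ∀ i, p₀.edges.Disjoint (p i).edges := fun i e he he' =>
      Set.disjoint_left.1 hd (h₀F e he) (h₃ i e he')
    refine ⟨Fin.cons p₀ p, ?_, ?_, ?_⟩
    · intro i
      refine Fin.cases ?_ (fun i => ?_) i
      exacts [h₀, h₁ i]
    · intro i j
      refine Fin.cases ?_ (fun i => ?_) i <;> refine Fin.cases ?_ (fun j => ?_) j <;> intro hij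
      · exact absurd rfl hij
      · exact hdisj j
      · exact (hdisj i).symm
      · exact h₂ fun e => hij (congrArg Fin.succ e)
    · intro i
      refine Fin.cases (fun e he => hFS.1 (h₀F e he)) (fun i e he => hFS.2 (h₃ i e he)) i

theorem le_of_maxmaxflow_le {Λ : ℕ} (h : G.HasFlow x y n S) (hΛ : G.maxmaxflow ≤ Λ)
    (hx : x ∈ V(G)) (hy : y ∈ V(G)) (hxy : x ≠ y) : n ≤ Λ := by
  have : (n : ℕ∞) ≤ G.maxmaxflow :=
    calc (n : ℕ∞) ≤ G.maxFlow x y :=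
          le_iSup₂_of_le n (h.hasEdgeDisjointPaths hy) le_rfl
      _ ≤ G.maxmaxflow :=
          le_iSup₂_of_le x hx (le_iSup₂_of_le y hy (le_iSup_of_le hxy le_rfl))
  exact_mod_cast this.trans hΛ

end HasFlow

theorem HasEdgeDisjointPaths.mono {n : ℕ} (h : G.HasEdgeDisjointPaths x y n) (hGH : G ≤ H) :
    H.HasEdgeDisjointPaths x y n := by
  have lift : ∀ {x y} (p : G.Walk x y), ∃ p' : H.Walk x y, p'.support = p.support ∧
      p'.edges = p.edges := by
    intro x y p
    induction p with
    | nil hx => exact ⟨.nil (hGH.vertexSet_mono hx), rfl, rfl⟩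
    | cons e h p ih =>
      obtain ⟨p', h₁, h₂⟩ := ih
      exact ⟨.cons e (h.mono hGH) p', congrArg _ h₁, congrArg _ h₂⟩
  obtain ⟨p, h₁, h₂⟩ := h
  choose p' hs he using fun i => lift (p i)
  exact ⟨p', fun i => by rw [Walk.IsPath, hs]; exact h₁ i, fun i j hij => by
    simpa only [he] using h₂ hij⟩

theorem maxmaxflow_mono (hGH : G ≤ H) : G.maxmaxflow ≤ H.maxmaxflow := by
  refine iSup₂_le fun x hx => iSup₂_le fun y hy => iSup_le fun hxy => ?_
  refine le_trans ?_ (le_iSup₂_of_le x (hGH.vertexSet_mono hx)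
    (le_iSup₂_of_le y (hGH.vertexSet_mono hy) (le_iSup_of_le hxy le_rfl)))
  exact iSup₂_le fun n hn => le_iSup₂_of_le n (hn.mono hGH) le_rfl

theorem le_restrict_edgeSet (hGH : G ≤ H) : G ≤ H.restrict E(G) := by
  simpa using restrict_mono_left hGH E(G)

end Graph

/-! ### Finiteness, connectedness and flow in the class -/

namespace TwoTerminalGraph

variable {α β : Type*} {G : TwoTerminalGraph α β}

theorem InWheatstoneClass.finite (h : G.InWheatstoneClass) :
    V(G.graph).Finite ∧ E(G.graph).Finite := by
  induction h with
  | singleEdge h =>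
    obtain ⟨hV, e, hE, -⟩ := h
    rw [hV, hE]
    exact ⟨Set.toFinite _, Set.toFinite _⟩
  | bridge h =>
    obtain ⟨a, b, -, hV, e₁, e₂, e₃, e₄, e₅, -, hE, -⟩ := h
    rw [hV, hE]
    exact ⟨Set.toFinite _, Set.toFinite _⟩
  | parallel h _ _ ih₁ ih₂ | series h _ _ ih₁ ih₂ =>
    rw [h.union.vertexSet_eq, h.union.edgeSet_eq]
    exact ⟨ih₁.1.union ih₂.1, ih₁.2.union ih₂.2⟩

theorem InWheatstoneClass.conn (h : G.InWheatstoneClass) : G.graph.Conn G.s G.t := by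
  induction h with
  | singleEdge h =>
    obtain ⟨-, e, -, he⟩ := h
    exact .of_adj he.adj
  | bridge h =>
    obtain ⟨a, b, -, -, e₁, e₂, e₃, e₄, e₅, -, -, h₁, h₂, h₃, h₄, h₅⟩ := h
    exact (Graph.Conn.of_adj h₁.adj).trans (.of_adj h₄.adj)
  | @parallel H G₁ G₂ h _ _ ih₁ ih₂ =>
    rw [← h.left_s, ← h.left_t]
    exact ih₁.mono h.union.left_le
  | @series H G₁ G₂ h _ _ ih₁ ih₂ =>
    rw [← h.left_s, ← h.right_t]
    exact (ih₁.mono h.union.left_le).trans (h.middle ▸ ih₂.mono h.union.right_le)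

theorem IsWheatstoneBridge.hasFlow (h : G.IsWheatstoneBridge) :
    G.graph.HasFlow G.s G.t 2 E(G.graph) := by
  obtain ⟨a, b, -, -, e₁, e₂, e₃, e₄, e₅, hnd, hE, h₁, h₂, h₃, h₄, h₅⟩ := h
  have conn : ∀ {e e' c}, G.graph.IsLink e G.s c → G.graph.IsLink e' c G.t →
      G.graph.HasFlow G.s G.t 1 {e, e'} := fun {e e' c} he he' =>
    .of_conn ((Graph.Conn.of_adj (G := G.graph.restrict {e, e'}) ⟨e, .inl rfl, he⟩).trans
      (.of_adj ⟨e', .inr rfl, he'⟩))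
  refine ((conn h₁ h₄).add (conn h₂ h₅) ?_).mono_right ?_
  · simp only [List.nodup_cons, List.mem_cons, not_or] at hnd
    rw [Set.disjoint_left]
    rintro e (rfl | rfl) (rfl | rfl) <;> tauto
  · rw [hE]
    intro e
    simp only [Set.mem_union, Set.mem_insert_iff, Set.mem_singleton_iff]
    tauto

end TwoTerminalGraph

/-! ## The constant `ρ⋆` -/

/-- The sign of the derivative is that of the quadratic `p`, which decreases from `p 0 = L > 0` to
`p 1 = 4 - 2 L < 0` and so vanishes exactly once in between. -/
theorem exists_log_shape {L : ℝ} (hL : 3 ≤ L) : ∃ c ∈ Set.Ioo (0 : ℝ) 1,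
    StrictMonoOn (fun x => L * Real.log (1 + x) - (L - 1) * Real.log (1 + x ^ 2)) (Set.Icc 0 c) ∧
    StrictAntiOn (fun x => L * Real.log (1 + x) - (L - 1) * Real.log (1 + x ^ 2)) (Set.Icc c 1) := by
  set f : ℝ → ℝ := fun x => L * Real.log (1 + x) - (L - 1) * Real.log (1 + x ^ 2) with hf
  let p : ℝ → ℝ := fun x => L - 2 * (L - 1) * x - (L - 2) * x ^ 2
  have hderiv : ∀ x, 0 ≤ x → HasDerivAt f (p x / ((1 + x) * (1 + x ^ 2))) x := by
    intro x hx
    have h₁ : 1 + x ≠ 0 := by positivity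
    have h₂ : 1 + x ^ 2 ≠ 0 := by positivity
    have d₁ := (((hasDerivAt_id x).const_add 1).log h₁).const_mul L
    have d₂ := (((hasDerivAt_pow 2 x).const_add 1).log h₂).const_mul (L - 1)
    refine (d₁.sub d₂).congr_deriv ?_
    simp only [p, id]
    field_simp
    push_cast
    ring
  have hp : ∀ x y, 0 ≤ x → x < y → p y < p x := by
    intro x y hx hxy
    have : p x - p y = (y - x) * (2 * (L - 1) + (L - 2) * (x + y)) := by simp only [p]; ring
    have : 0 < (y - x) * (2 * (L - 1) + (L - 2) * (x + y)) :=
      mul_pos (by linarith) (add_pos_of_pos_of_nonneg (by linarith)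
        (mul_nonneg (by linarith) (by linarith)))
    linarith
  have hc : ContinuousOn p (Set.Icc 0 1) := by fun_prop
  obtain ⟨c, hc, hpc⟩ := intermediate_value_Icc' (zero_le_one (α := ℝ)) hc
    (show (0 : ℝ) ∈ Set.Icc (p 1) (p 0) by constructor <;> simp only [p] <;> linarith)
  have hc0 : c ≠ 0 := by
    rintro rfl
    simp only [p] at hpc
    linarith
  have hc1 : c ≠ 1 := by
    rintro rfl
    simp only [p] at hpc
    linarith
  have c0 : 0 < c := lt_of_le_of_ne hc.1 hc0.symm
  refine ⟨c, ⟨c0, lt_of_le_of_ne hc.2 hc1⟩, ?_, ?_⟩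
  · refine strictMonoOn_of_deriv_pos (convex_Icc 0 c)
      (fun x hx => (hderiv x hx.1).continuousAt.continuousWithinAt) fun x hx => ?_
    rw [interior_Icc] at hx
    rw [(hderiv x hx.1.le).deriv]
    have := hp x c hx.1.le hx.2
    have := hx.1
    apply div_pos <;> [linarith; positivity]
  · refine strictAntiOn_of_deriv_neg (convex_Icc c 1)
      (fun x hx => (hderiv x (c0.le.trans hx.1)).continuousAt.continuousWithinAt) fun x hx => ?_
    rw [interior_Icc] at hx
    have hx0 := c0.trans hx.1
    rw [(hderiv x hx0.le).deriv]
    have := hp c x c0.le hx.1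
    apply div_neg_of_neg_of_pos <;> [linarith; positivity]

theorem log_shape_le_iff {Λ : ℕ} (hΛ : 3 ≤ Λ) {x : ℝ} (hx : 0 ≤ x) :
    ((Λ : ℝ) * Real.log (1 + x) - ((Λ : ℝ) - 1) * Real.log (1 + x ^ 2) ≤ Real.log 2 ↔
      (1 + x) ^ Λ ≤ 2 * (1 + x ^ 2) ^ (Λ - 1)) ∧
    ((Λ : ℝ) * Real.log (1 + x) - ((Λ : ℝ) - 1) * Real.log (1 + x ^ 2) = Real.log 2 ↔
      (1 + x) ^ Λ = 2 * (1 + x ^ 2) ^ (Λ - 1)) := by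
  have h₁ : 0 < (1 + x) ^ Λ := by positivity
  have h₂ : 0 < 2 * (1 + x ^ 2) ^ (Λ - 1) := by positivity
  have e₁ : Real.log ((1 + x) ^ Λ) = Λ * Real.log (1 + x) := Real.log_pow _ _
  have e₂ : Real.log (2 * (1 + x ^ 2) ^ (Λ - 1)) =
      Real.log 2 + ((Λ : ℝ) - 1) * Real.log (1 + x ^ 2) := by
    rw [Real.log_mul (by norm_num) (by positivity), Real.log_pow, Nat.cast_sub (by omega)]
    simp
  constructor
  · rw [← Real.log_le_log_iff h₁ h₂, e₁, e₂, sub_le_iff_le_add]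
  · rw [← Real.log_injOn_pos.eq_iff h₁ h₂, e₁, e₂, sub_eq_iff_eq_add]

/-- In logarithmic form the equation reads `f = log 2`. Since `f 1 = log 2` and `f` decreases on
`[c, 1]`, no solution in `(0, 1)` lies beyond `c`. On `[0, c]` the function increases from `0` to a
value above `log 2`, which gives uniqueness and also the inequality to the left of the solution. -/
theorem existsUnique_isRhoStar_and_le {Λ : ℕ} (hΛ : 3 ≤ Λ) :
    (∃! ρ, IsRhoStar Λ ρ) ∧ ∀ ρ', IsRhoStar Λ ρ' → ∀ ρ, 0 ≤ ρ → ρ ≤ ρ' →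
      (1 + ρ) ^ Λ ≤ 2 * (1 + ρ ^ 2) ^ (Λ - 1) := by
  obtain ⟨c, ⟨c0, c1⟩, hmono, hanti⟩ := exists_log_shape (L := Λ) (by exact_mod_cast hΛ)
  set f : ℝ → ℝ := fun x => (Λ : ℝ) * Real.log (1 + x) - ((Λ : ℝ) - 1) * Real.log (1 + x ^ 2)
    with hf
  have f0 : f 0 = 0 := by simp [hf]
  have f1 : f 1 = Real.log 2 := by norm_num [hf]; ring
  have hstar : ∀ ρ, IsRhoStar Λ ρ → ρ ∈ Set.Icc 0 c ∧ f ρ = Real.log 2 := by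
    rintro ρ ⟨h0, h1, h⟩
    have e : f ρ = Real.log 2 := (log_shape_le_iff hΛ h0.le).2.2 h
    refine ⟨⟨h0.le, ?_⟩, e⟩
    by_contra! hlt
    have := hanti ⟨hlt.le, h1.le⟩ ⟨c1.le, le_rfl⟩ h1
    rw [f1] at this
    exact this.ne' e
  have hcont : ContinuousOn f (Set.Icc 0 c) := by
    intro x hx
    have : 1 + x ≠ 0 := by have := hx.1; positivity
    have : 1 + x ^ 2 ≠ 0 := by positivity
    refine ContinuousAt.continuousWithinAt ?_
    rw [hf]
    fun_prop (disch := assumption)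
  have fc : Real.log 2 < f c := f1 ▸ hanti ⟨le_rfl, c1.le⟩ ⟨c1.le, le_rfl⟩ c1
  have l2 : 0 < Real.log 2 := Real.log_pos (by norm_num)
  constructor
  · obtain ⟨ρ, hρ, e⟩ := intermediate_value_Icc c0.le hcont
      (show Real.log 2 ∈ Set.Icc (f 0) (f c) from ⟨f0.symm ▸ l2.le, fc.le⟩)
    have h0 : ρ ≠ 0 := by rintro rfl; rw [f0] at e; exact l2.ne e
    refine ⟨ρ, ⟨lt_of_le_of_ne hρ.1 h0.symm, hρ.2.trans_lt c1,
      (log_shape_le_iff hΛ hρ.1).2.1 e⟩, fun ρ' h' => ?_⟩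
    obtain ⟨hm, e'⟩ := hstar ρ' h'
    exact hmono.injOn hm hρ (e'.trans e.symm)
  · intro ρ' h' ρ h0 hle
    obtain ⟨hm, e'⟩ := hstar ρ' h'
    exact (log_shape_le_iff hΛ h0).1.1
      (e' ▸ hmono.monotoneOn ⟨h0, hle.trans hm.2⟩ hm hle)

/-! ## The radii -/

/-- The radius of the disc that contains the transmissivities of the graphs with flow `k`. -/
noncomputable def flowRadius (ρ X : ℝ) (k : ℕ) : ℝ := ρ * (X ^ k - 1) / (1 - ρ * X ^ k)

section FlowRadius

variable {ρ X : ℝ} {N k l : ℕ}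

/-- This keeps the denominator of `flowRadius` positive for all `k ≤ N`. -/
theorem mul_pow_lt_one (h0 : 0 < ρ) (h1 : ρ < 1) (hX : 1 ≤ X) (hXN : X ^ N = 2 / (1 + ρ))
    (hk : k ≤ N) : X ^ k * (1 + ρ) ≤ 2 ∧ ρ * X ^ k < 1 := by
  have h : X ^ k ≤ 2 / (1 + ρ) := hXN ▸ pow_le_pow_right₀ hX hk
  rw [le_div_iff₀ (by linarith)] at h
  have : 1 ≤ X ^ k := one_le_pow₀ hX
  exact ⟨h, by nlinarith⟩

theorem flowRadius_nonneg_and_le (h0 : 0 < ρ) (h1 : ρ < 1) (hX : 1 ≤ X)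
    (hXN : X ^ N = 2 / (1 + ρ)) (hk : k ≤ N) : 0 ≤ flowRadius ρ X k ∧ flowRadius ρ X k ≤ ρ := by
  obtain ⟨h₁, h₂⟩ := mul_pow_lt_one h0 h1 hX hXN hk
  have : 1 ≤ X ^ k := one_le_pow₀ hX
  constructor
  · exact div_nonneg (mul_nonneg h0.le (by linarith)) (by linarith)
  · rw [flowRadius, div_le_iff₀ (by linarith)]
    exact mul_le_mul_of_nonneg_left (by linarith) h0.le

theorem sq_le_flowRadius_one (h0 : 0 < ρ) (h1 : ρ < 1) (hX : 1 ≤ X) (hN : 1 ≤ N)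
    (hXN : X ^ N = 2 / (1 + ρ)) (h : (1 + ρ) ^ (N + 1) ≤ 2 * (1 + ρ ^ 2) ^ N) :
    ρ ^ 2 ≤ flowRadius ρ X 1 := by
  obtain ⟨-, h₂⟩ := mul_pow_lt_one h0 h1 hX hXN hN
  -- After clearing denominators the claim is this inequality; its `N`-th power, with `X ^ N = 2 /
  -- (1 + ρ)`, is `h`.
  have key : 1 + ρ ≤ X * (1 + ρ ^ 2) := by
    refine le_of_pow_le_pow_left₀ (n := N) (by omega) (by positivity) ?_
    rw [mul_pow, hXN, div_mul_eq_mul_div, le_div_iff₀ (by linarith), ← pow_succ]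
    exact h
  rw [flowRadius, le_div_iff₀ (by linarith), pow_one]
  nlinarith

/-- Solving for the power gives `X ^ k = (1 + r / ρ) / (1 + r)` with `r = flowRadius ρ X k`. In this
Möbius coordinate the parallel law for the radii becomes multiplication. -/
theorem flowRadius_add (h0 : 0 < ρ) (h1 : ρ < 1) (hX : 1 ≤ X)
    (hXN : X ^ N = 2 / (1 + ρ)) (hkl : k + l ≤ N) :
    flowRadius ρ X k + flowRadius ρ X l + (1 / ρ + 1) * (flowRadius ρ X k * flowRadius ρ X l) =
      flowRadius ρ X (k + l) * (1 - 1 / ρ * (flowRadius ρ X k * flowRadius ρ X l)) := by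
  have hk := (mul_pow_lt_one h0 h1 hX hXN (k := k) (by omega)).2
  have hl := (mul_pow_lt_one h0 h1 hX hXN (k := l) (by omega)).2
  have hkl := (mul_pow_lt_one h0 h1 hX hXN hkl).2
  simp only [flowRadius, pow_add] at *
  generalize X ^ k = a at *
  generalize X ^ l = b at *
  have h₁ : 1 - ρ * a ≠ 0 := by linarith
  have h₂ : 1 - ρ * b ≠ 0 := by linarith
  have h₃ : 1 - ρ * a * b ≠ 0 := by linarith
  field_simp
  ring

end FlowRadius

theorem one_lt_wheatstoneX {Λ : ℕ} (hΛ : 3 ≤ Λ) {ρ : ℝ} (h0 : 0 < ρ) (h1 : ρ < 1) :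
    1 < wheatstoneX Λ ρ := by
  have : (3 : ℝ) ≤ Λ := by exact_mod_cast hΛ
  refine Real.one_lt_rpow ?_ (by apply one_div_pos.2; linarith)
  rw [lt_div_iff₀ (by linarith)]
  linarith

theorem wheatstoneX_pow {Λ : ℕ} (hΛ : 3 ≤ Λ) {ρ : ℝ} (h0 : 0 < ρ) :
    wheatstoneX Λ ρ ^ (Λ - 1) = 2 / (1 + ρ) := by
  have : ((Λ : ℝ) - 1) = ((Λ - 1 : ℕ) : ℝ) := by rw [Nat.cast_sub (by omega)]; simp
  rw [wheatstoneX, this, one_div]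
  exact Real.rpow_inv_natCast_pow (by positivity) (by omega)

theorem two_mul_le_flowRadius_two {Λ : ℕ} (hΛ : 3 ≤ Λ) {q : ℂ} (hq : 1 < ‖q - 1‖)
    (hb : wheatstoneBound Λ q ≤ ‖q - 2‖) :
    2 * (1 / ‖q - 1‖) ≤ flowRadius (1 / ‖q - 1‖) (wheatstoneX Λ (1 / ‖q - 1‖)) 2 * ‖q - 2‖ := by
  simp only [wheatstoneBound] at hb
  have h0 : 0 < 1 / ‖q - 1‖ := by positivity
  have h1 : 1 / ‖q - 1‖ < 1 := by rw [div_lt_one (by linarith)]; exact hq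
  generalize 1 / ‖q - 1‖ = ρ at *
  have hX := one_lt_wheatstoneX hΛ h0 h1
  have h := (mul_pow_lt_one h0 h1 hX.le (wheatstoneX_pow hΛ h0) (k := 2) (by omega)).2
  generalize wheatstoneX Λ ρ = X at *
  have hX2 : 0 < X ^ 2 - 1 := by nlinarith
  rw [div_le_iff₀ hX2] at hb
  rw [flowRadius, div_mul_eq_mul_div, le_div_iff₀ (by linarith)]
  nlinarith

theorem wheatstoneBound_three {q : ℂ} (hq : 1 < ‖q - 1‖) : wheatstoneBound 3 q = 2 := by
  simp only [wheatstoneBound]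
  have h0 : 0 < 1 / ‖q - 1‖ := by positivity
  have h1 : 1 / ‖q - 1‖ < 1 := by rw [div_lt_one (by linarith)]; exact hq
  generalize 1 / ‖q - 1‖ = ρ at *
  have h := wheatstoneX_pow (Λ := 3) le_rfl h0
  norm_num at h
  rw [h, div_eq_iff]
  · field_simp; ring
  · have : 1 - ρ ≠ 0 := by linarith
    rw [div_sub_one (by linarith)]
    exact div_ne_zero (fun h' => this (by linarith)) (by linarith)

/-- The disc bounds for the transmissivity of a parallel composition. -/
theorem norm_parallel_le {q c₁ z₁ c₂ z₂ : ℂ} {r₁ r₂ r Q : ℝ} (hQ : ‖q - 1‖ = Q) (hr₁ : 0 ≤ r₁)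
    (h₁ : ‖c₁‖ ≤ r₁ * ‖z₁‖) (h₂ : ‖c₂‖ ≤ r₂ * ‖z₂‖) :
    (1 - Q * (r₁ * r₂)) * (‖z₁‖ * ‖z₂‖) ≤ ‖z₁ * z₂ + (q - 1) * (c₁ * c₂)‖ ∧
    (0 ≤ r → r₁ + r₂ + (Q + 1) * (r₁ * r₂) = r * (1 - Q * (r₁ * r₂)) →
      ‖c₁ * z₂ + z₁ * c₂ + (q - 2) * (c₁ * c₂)‖ ≤ r * ‖z₁ * z₂ + (q - 1) * (c₁ * c₂)‖) := by
  have hQ0 : 0 ≤ Q := hQ ▸ norm_nonneg _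
  have hcc : ‖c₁ * c₂‖ ≤ r₁ * r₂ * (‖z₁‖ * ‖z₂‖) := by
    rw [norm_mul, mul_mul_mul_comm]
    exact mul_le_mul h₁ h₂ (norm_nonneg _) (by positivity)
  have hz : (1 - Q * (r₁ * r₂)) * (‖z₁‖ * ‖z₂‖) ≤ ‖z₁ * z₂ + (q - 1) * (c₁ * c₂)‖ := by
    have h := norm_sub_le (z₁ * z₂ + (q - 1) * (c₁ * c₂)) ((q - 1) * (c₁ * c₂))
    rw [add_sub_cancel_right, norm_mul z₁, norm_mul (q - 1), hQ] at h
    have := mul_le_mul_of_nonneg_left hcc hQ0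
    linarith
  refine ⟨hz, fun hr e => ?_⟩
  have hq2 : ‖q - 2‖ ≤ Q + 1 := by
    have := norm_sub_le (q - 1) 1
    rwa [hQ, norm_one, sub_sub, one_add_one_eq_two] at this
  calc ‖c₁ * z₂ + z₁ * c₂ + (q - 2) * (c₁ * c₂)‖
      ≤ ‖c₁‖ * ‖z₂‖ + ‖z₁‖ * ‖c₂‖ + ‖q - 2‖ * ‖c₁ * c₂‖ := by
        refine (norm_add₃_le).trans ?_
        rw [norm_mul c₁ z₂, norm_mul z₁, norm_mul (q - 2)]
    _ ≤ r₁ * ‖z₁‖ * ‖z₂‖ + ‖z₁‖ * (r₂ * ‖z₂‖) + (Q + 1) * (r₁ * r₂ * (‖z₁‖ * ‖z₂‖)) := by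
        gcongr
    _ = r * ((1 - Q * (r₁ * r₂)) * (‖z₁‖ * ‖z₂‖)) := by rw [← mul_assoc r, ← e]; ring
    _ ≤ _ := by gcongr

/-- The numerical facts about the radii `r k` that the induction over the class `𝒲` uses. -/
structure IsFlowRadii (Λ : ℕ) (q : ℂ) (r : ℕ → ℝ) : Prop where
  three_le : 3 ≤ Λ
  one_lt : 1 < ‖q - 1‖
  nonneg_and_le : ∀ k, k + 1 ≤ Λ → 0 ≤ r k ∧ r k ≤ 1 / ‖q - 1‖
  sq_le : (1 / ‖q - 1‖) ^ 2 ≤ r 1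
  add : ∀ k l, k + l + 1 ≤ Λ →
    r k + r l + (‖q - 1‖ + 1) * (r k * r l) = r (k + l) * (1 - ‖q - 1‖ * (r k * r l))
  two : 2 * (1 / ‖q - 1‖) ≤ r 2 * ‖q - 2‖

namespace IsFlowRadii

variable {Λ : ℕ} {q : ℂ} {r : ℕ → ℝ}

theorem ne_zero (hr : IsFlowRadii Λ q r) : q ≠ 0 := by
  rintro rfl
  simpa using hr.one_lt

theorem sub_one_ne_zero (hr : IsFlowRadii Λ q r) : q - 1 ≠ 0 :=
  norm_pos_iff.1 (zero_lt_one.trans hr.one_lt)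

theorem sub_two_ne_zero (hr : IsFlowRadii Λ q r) : q - 2 ≠ 0 := by
  intro h
  have := hr.one_lt
  rw [sub_eq_zero.1 h] at this
  norm_num at this

theorem parallel_ne_zero (hr : IsFlowRadii Λ q r) {c₁ z₁ c₂ z₂ : ℂ}
    (hz₁ : z₁ ≠ 0) (hz₂ : z₂ ≠ 0) (h₁ : ‖c₁‖ ≤ 1 / ‖q - 1‖ * ‖z₁‖)
    (h₂ : ‖c₂‖ ≤ 1 / ‖q - 1‖ * ‖z₂‖) : z₁ * z₂ + (q - 1) * (c₁ * c₂) ≠ 0 := by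
  have hQ := hr.one_lt
  -- Only the first conclusion is used, so the value of `r` is irrelevant.
  have h := (norm_parallel_le (q := q) (r := 0) rfl (by positivity) h₁ h₂).1
  rw [← norm_pos_iff]
  refine lt_of_lt_of_le ?_ h
  have e : 1 - ‖q - 1‖ * (1 / ‖q - 1‖ * (1 / ‖q - 1‖)) = 1 - 1 / ‖q - 1‖ := by
    field_simp
  have hlt : 1 / ‖q - 1‖ < 1 := by rwa [div_lt_one (by linarith)]
  rw [e]
  exact mul_pos (by linarith) (mul_pos (norm_pos_iff.2 hz₁) (norm_pos_iff.2 hz₂))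

end IsFlowRadii

/-- The condition on `‖q - 1‖` yields `sq_le` through `ρ ≤ ρ⋆`; the condition on `‖q - 2‖` yields
`two`. -/
theorem isFlowRadii_flowRadius {Λ : ℕ} (hΛ : 3 ≤ Λ) {ρstar : ℝ} (hρ : IsRhoStar Λ ρstar) {q : ℂ}
    (hq : 1 / ρstar ≤ ‖q - 1‖) (hb : wheatstoneBound Λ q ≤ ‖q - 2‖) :
    IsFlowRadii Λ q (flowRadius (1 / ‖q - 1‖) (wheatstoneX Λ (1 / ‖q - 1‖))) := by
  have hQ : 1 < ‖q - 1‖ := lt_of_lt_of_le ((one_lt_div hρ.1).2 hρ.2.1) hq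
  have h0 : 0 < 1 / ‖q - 1‖ := by positivity
  have h1 : 1 / ‖q - 1‖ < 1 := by rwa [div_lt_one (by linarith)]
  have hle : 1 / ‖q - 1‖ ≤ ρstar := (one_div_le hρ.1 (by linarith)).1 hq
  have hX := (one_lt_wheatstoneX hΛ h0 h1).le
  have hXN := wheatstoneX_pow hΛ h0
  have hineq := (existsUnique_isRhoStar_and_le hΛ).2 ρstar hρ _ h0.le hle
  refine ⟨hΛ, hQ, fun k hk => flowRadius_nonneg_and_le h0 h1 hX hXN (by omega),
    sq_le_flowRadius_one h0 h1 hX (by omega) hXN ?_, fun k l hkl => ?_,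
    two_mul_le_flowRadius_two hΛ hQ hb⟩
  · rwa [Nat.sub_add_cancel (by omega)]
  · simpa only [one_div_one_div] using flowRadius_add h0 h1 hX hXN (k := k) (l := l) (by omega)

/-! ### The transmissivity invariant and the induction over the class -/

namespace TwoTerminalGraph

variable {α β : Type*} {G G₁ G₂ : TwoTerminalGraph α β} {Λ : ℕ} {q : ℂ} {r : ℕ → ℝ}

/-- The transmissivity of `G` is that of a single edge, or it lies in the disc of radius `r k` for
some number `k` of edge-disjoint paths between the terminals. -/
def TransmissivityBound (G : TwoTerminalGraph α β) (Λ : ℕ) (q : ℂ) (r : ℕ → ℝ) : Prop :=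
  G.graph.chromaticPolynomial q ≠ 0 ∧
    ((q - 1) * G.graph.connectingPolynomial G.s G.t q = -G.graph.chromaticPolynomial q ∨
      ∃ k, k + 1 ≤ Λ ∧ G.graph.HasFlow G.s G.t k E(G.graph) ∧
        ‖G.graph.connectingPolynomial G.s G.t q‖ ≤ r k * ‖G.graph.chromaticPolynomial q‖)

theorem TransmissivityBound.norm_le (hr : IsFlowRadii Λ q r) (h : G.TransmissivityBound Λ q r) :
    ‖G.graph.connectingPolynomial G.s G.t q‖ ≤
      1 / ‖q - 1‖ * ‖G.graph.chromaticPolynomial q‖ := by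
  have hQ := hr.one_lt
  rcases h.2 with h | ⟨k, hk, -, h⟩
  · rw [← norm_neg (G.graph.chromaticPolynomial q), ← h, norm_mul]
    refine le_of_eq ?_
    field_simp
  · exact h.trans (mul_le_mul_of_nonneg_right (hr.nonneg_and_le k hk).2 (norm_nonneg _))

/-- The terminals of `G` are connected in `H` by edges outside `G`. -/
def IsBypassed (G : TwoTerminalGraph α β) (H : Graph α β) : Prop :=
  (H.restrict E(G.graph)ᶜ).Conn G.s G.t

theorem IsBypassed.succ_le {H : Graph α β} (hout : G.IsBypassed H) (hGH : G.graph ≤ H)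
    (hΛ : H.maxmaxflow ≤ Λ) {k : ℕ} (h : G.graph.HasFlow G.s G.t k E(G.graph)) : k + 1 ≤ Λ :=
  ((h.mono_left hGH).add (.of_conn hout) disjoint_compl_right).le_of_maxmaxflow_le hΛ
    (hGH.vertexSet_mono G.s_mem) (hGH.vertexSet_mono G.t_mem) G.s_ne_t

theorem IsSingleEdge.transmissivityBound (hr : IsFlowRadii Λ q r) (h : G.IsSingleEdge) :
    G.TransmissivityBound Λ q r := by
  obtain ⟨hz, hc⟩ := h.polynomials q
  rw [TransmissivityBound, hz, hc]
  refine ⟨?_, .inl (by ring)⟩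
  rw [show q ^ 2 - q = q * (q - 1) by ring]
  exact mul_ne_zero hr.ne_zero hr.sub_one_ne_zero

theorem IsWheatstoneBridge.transmissivityBound (hr : IsFlowRadii Λ q r)
    (h : G.IsWheatstoneBridge) : G.TransmissivityBound Λ q r := by
  obtain ⟨hz, hc⟩ := h.polynomials q
  rw [TransmissivityBound, hz, hc]
  refine ⟨mul_ne_zero (mul_ne_zero hr.ne_zero hr.sub_one_ne_zero)
    (pow_ne_zero 2 hr.sub_two_ne_zero), .inr ⟨2, hr.three_le, h.hasFlow, ?_⟩⟩
  have hQ := hr.one_lt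
  have h2 := hr.two
  simp only [norm_mul, norm_pow, Complex.norm_ofNat]
  rw [← mul_div_assoc, mul_one, div_le_iff₀ (by linarith)] at h2
  calc 2 * ‖q‖ * ‖q - 2‖ = 2 * (‖q‖ * ‖q - 2‖) := by ring
    _ ≤ r 2 * ‖q - 2‖ * ‖q - 1‖ * (‖q‖ * ‖q - 2‖) := by gcongr
    _ = _ := by ring

theorem IsSeriesComposition.transmissivityBound (hr : IsFlowRadii Λ q r)
    (h : G.IsSeriesComposition G₁ G₂) (hfin : V(G.graph).Finite ∧ E(G.graph).Finite)
    (hconn : G.graph.Conn G.s G.t) (h₁ : G₁.TransmissivityBound Λ q r)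
    (h₂ : G₂.TransmissivityBound Λ q r) : G.TransmissivityBound Λ q r := by
  obtain ⟨hz, hc⟩ := h.union.series_polynomials hfin.1 hfin.2 h.inter G₁.s_mem G₂.t_mem q
  rw [h.left_s, h.right_t] at hc
  have n₁ := h₁.norm_le hr
  have n₂ := h₂.norm_le hr
  rw [h.left_s] at n₁
  rw [← h.middle, h.right_t] at n₂
  have hQ := hr.one_lt
  have hL := hr.three_le
  -- Flow 1, witnessed by connectedness, is enough: the product of two transmissivities of modulus
  -- at most `ρ` lies within `ρ ^ 2 ≤ r 1`.
  refine ⟨fun h0 => ?_, .inr ⟨1, by omega, .of_conn (by simpa using hconn), ?_⟩⟩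
  · rw [h0, mul_zero] at hz
    exact mul_ne_zero h₁.1 h₂.1 hz.symm
  · refine le_of_mul_le_mul_left ?_ (norm_pos_iff.2 hr.ne_zero)
    rw [mul_left_comm, ← norm_mul, ← norm_mul, hz, hc, norm_mul, norm_mul]
    refine (mul_le_mul n₁ n₂ (norm_nonneg _) (by positivity)).trans ?_
    rw [mul_mul_mul_comm, ← sq]
    exact mul_le_mul_of_nonneg_right hr.sq_le (by positivity)

theorem IsParallelComposition.chromaticPolynomial_ne_zero (hr : IsFlowRadii Λ q r)
    (h : G.IsParallelComposition G₁ G₂) (hfin : V(G.graph).Finite ∧ E(G.graph).Finite)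
    (h₁ : G₁.TransmissivityBound Λ q r) (h₂ : G₂.TransmissivityBound Λ q r) :
    G.graph.chromaticPolynomial q ≠ 0 := by
  have n₁ := h₁.norm_le hr
  have n₂ := h₂.norm_le hr
  rw [h.left_s, h.left_t] at n₁
  rw [h.right_s, h.right_t] at n₂
  intro h0
  have hz := (h.union.parallel_polynomials hfin.1 hfin.2 h.inter q).1
  rw [h0, mul_zero] at hz
  exact hr.parallel_ne_zero h₁.1 h₂.1 n₁ n₂ hz.symm

theorem IsParallelComposition.transmissivityBound (hr : IsFlowRadii Λ q r)
    (h : G.IsParallelComposition G₁ G₂) (hfin : V(G.graph).Finite ∧ E(G.graph).Finite)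
    (hΛ : ∀ k, G.graph.HasFlow G.s G.t k E(G.graph) → k + 1 ≤ Λ)
    (h₁ : G₁.TransmissivityBound Λ q r) (h₂ : G₂.TransmissivityBound Λ q r) :
    G.TransmissivityBound Λ q r := by
  refine ⟨h.chromaticPolynomial_ne_zero hr hfin h₁ h₂, ?_⟩
  obtain ⟨hz, hc⟩ := h.union.parallel_polynomials hfin.1 hfin.2 h.inter q
  obtain ⟨-, h₁⟩ := h₁
  obtain ⟨-, h₂⟩ := h₂
  rw [h.left_s, h.left_t] at h₁
  rw [h.right_s, h.right_t] at h₂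
  have hq2 : q ^ 2 ≠ 0 := pow_ne_zero 2 hr.ne_zero
  generalize G₁.graph.chromaticPolynomial q = z₁ at *
  generalize G₂.graph.chromaticPolynomial q = z₂ at *
  generalize G₁.graph.connectingPolynomial G.s G.t q = c₁ at *
  generalize G₂.graph.connectingPolynomial G.s G.t q = c₂ at *
  rcases h₁ with h₁ | ⟨k, hk, hf₁, h₁⟩
  · left
    apply mul_left_cancel₀ hq2
    -- Up to `q ^ 2`, the quantity `z + (q - 1) c` is multiplicative under parallel composition, so
    -- it vanishes as soon as it does for one part.
    linear_combination (q - 1) * hc + hz + (z₂ + (q - 1) * c₂) * h₁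
  rcases h₂ with h₂ | ⟨l, hl, hf₂, h₂⟩
  · left
    apply mul_left_cancel₀ hq2
    linear_combination (q - 1) * hc + hz + (z₁ + (q - 1) * c₁) * h₂
  right
  have hf : G.graph.HasFlow G.s G.t (k + l) E(G.graph) := by
    rw [h.union.edgeSet_eq]
    exact (hf₁.mono_left h.union.left_le).add (hf₂.mono_left h.union.right_le)
      h.union.disjoint_edgeSet
  have hkl := hΛ _ hf
  refine ⟨k + l, hkl, hf, le_of_mul_le_mul_left ?_ (norm_pos_iff.2 hq2)⟩
  rw [mul_left_comm, ← norm_mul, ← norm_mul, hz, hc]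
  exact (norm_parallel_le rfl (hr.nonneg_and_le k hk).1 h₁ h₂).2 (hr.nonneg_and_le _ hkl).1
    (hr.add k l hkl)

/-- The ambient graph `H` stays fixed while the induction descends into `G`: parts inherit the
bypass, and this bypass, together with a flow across `G`, gives the bound `k + 1 ≤ Λ`. -/
theorem InWheatstoneClass.transmissivityBound (hr : IsFlowRadii Λ q r)
    (hG : G.InWheatstoneClass) {H : Graph α β} (hGH : G.graph ≤ H) (hΛ : H.maxmaxflow ≤ Λ)
    (hout : G.IsBypassed H) : G.TransmissivityBound Λ q r := by
  induction hG with
  | singleEdge h => exact h.transmissivityBound hr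
  | bridge h => exact h.transmissivityBound hr
  | @parallel G G₁ G₂ h hG₁ hG₂ ih₁ ih₂ =>
    have le₁ := h.union.left_le
    have le₂ := h.union.right_le
    refine h.transmissivityBound hr (InWheatstoneClass.parallel h hG₁ hG₂).finite
      (fun k hk => hout.succ_le hGH hΛ hk) (ih₁ (le₁.trans hGH) ?_) (ih₂ (le₂.trans hGH) ?_)
    · rw [IsBypassed, h.left_s, h.left_t]
      exact hout.mono (Graph.restrict_mono_right _ (Set.compl_subset_compl.2 le₁.edgeSet_mono))
    · rw [IsBypassed, h.right_s, h.right_t]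
      exact hout.mono (Graph.restrict_mono_right _ (Set.compl_subset_compl.2 le₂.edgeSet_mono))
  | @series G G₁ G₂ h hG₁ hG₂ ih₁ ih₂ =>
    have le₁ := h.union.left_le
    have le₂ := h.union.right_le
    have hG := InWheatstoneClass.series h hG₁ hG₂
    have hd := h.union.disjoint_edgeSet
    refine h.transmissivityBound hr hG.finite hG.conn (ih₁ (le₁.trans hGH) ?_)
      (ih₂ (le₂.trans hGH) ?_)
    -- The bypass of `G₁` runs from `s` to `t` outside `G` and then back through `G₂` to the middle
    -- vertex.
    · have o := hout.mono
        (Graph.restrict_mono_right _ (Set.compl_subset_compl.2 le₁.edgeSet_mono))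
      have o₂ := (hG₂.conn.mono (Graph.le_restrict_edgeSet (le₂.trans hGH))).mono
        (Graph.restrict_mono_right _ hd.subset_compl_left)
      rw [← h.middle, h.right_t] at o₂
      rw [IsBypassed, h.left_s]
      exact o.trans o₂.symm
    · have o := hout.mono
        (Graph.restrict_mono_right _ (Set.compl_subset_compl.2 le₂.edgeSet_mono))
      have o₁ := (hG₁.conn.mono (Graph.le_restrict_edgeSet (le₁.trans hGH))).mono
        (Graph.restrict_mono_right _ hd.subset_compl_right)
      rw [h.left_s] at o₁
      rw [IsBypassed, ← h.middle, h.right_t]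
      exact o₁.symm.trans o

/-- With no bypass of `G` itself, its flow may reach `Λ` and the disc bound is not available. Series
parts are treated recursively; in a parallel composition each part bypasses the other, so both
satisfy the invariant. -/
theorem InWheatstoneClass.chromaticPolynomial_ne_zero (hr : IsFlowRadii Λ q r)
    (hG : G.InWheatstoneClass) (hΛ : G.graph.maxmaxflow ≤ Λ) :
    G.graph.chromaticPolynomial q ≠ 0 := by
  induction hG with
  | singleEdge h => exact (h.transmissivityBound hr).1
  | bridge h => exact (h.transmissivityBound hr).1
  | @parallel G G₁ G₂ h hG₁ hG₂ _ _ =>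
    have le₁ := h.union.left_le
    have le₂ := h.union.right_le
    have hd := h.union.disjoint_edgeSet
    refine h.chromaticPolynomial_ne_zero hr (InWheatstoneClass.parallel h hG₁ hG₂).finite
      (hG₁.transmissivityBound hr le₁ hΛ ?_) (hG₂.transmissivityBound hr le₂ hΛ ?_)
    · have o₂ := (hG₂.conn.mono (Graph.le_restrict_edgeSet le₂)).mono
        (Graph.restrict_mono_right _ hd.subset_compl_left)
      rwa [h.right_s, h.right_t, ← h.left_s, ← h.left_t] at o₂
    · have o₁ := (hG₁.conn.mono (Graph.le_restrict_edgeSet le₁)).mono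
        (Graph.restrict_mono_right _ hd.subset_compl_right)
      rwa [h.left_s, h.left_t, ← h.right_s, ← h.right_t] at o₁
  | @series G G₁ G₂ h hG₁ hG₂ ih₁ ih₂ =>
    have hfin := (InWheatstoneClass.series h hG₁ hG₂).finite
    intro h0
    have hz := (h.union.series_polynomials hfin.1 hfin.2 h.inter G₁.s_mem G₂.t_mem q).1
    rw [h0, mul_zero] at hz
    exact mul_ne_zero (ih₁ ((Graph.maxmaxflow_mono h.union.left_le).trans hΛ))
      (ih₂ ((Graph.maxmaxflow_mono h.union.right_le).trans hΛ)) hz.symm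

end TwoTerminalGraph

theorem theorem8p2 {α β : Type*} (Λ : ℕ) (hΛ : 3 ≤ Λ) :
    (∃! ρstar : ℝ, IsRhoStar Λ ρstar) ∧
    ∀ ρstar : ℝ, IsRhoStar Λ ρstar →
      (∀ G : TwoTerminalGraph α β, G.InWheatstoneClass → G.graph.maxmaxflow ≤ Λ →
        ∀ q : ℂ, 1 / ρstar ≤ ‖q - 1‖ → wheatstoneBound Λ q ≤ ‖q - 2‖ →
          G.graph.chromaticPolynomial q ≠ 0) ∧
      (Λ = 3 → ∀ q : ℂ, 1 / ρstar ≤ ‖q - 1‖ →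
        (wheatstoneBound Λ q ≤ ‖q - 2‖ ↔ 2 ≤ ‖q - 2‖)) := by
  refine ⟨(existsUnique_isRhoStar_and_le hΛ).1, fun ρstar hρ => ⟨?_, ?_⟩⟩
  · intro G hG hmax q hq hb
    exact hG.chromaticPolynomial_ne_zero (isFlowRadii_flowRadius hΛ hρ hq hb) hmax
  · rintro rfl q hq
    rw [wheatstoneBound_three (lt_of_lt_of_le ((one_lt_div hρ.1).2 hρ.2.1) hq)]
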